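/- There are absolute constants $C, K > 0$ and $c \in \mathbb{N}$ such that for all integers $n \ge 3$ and $0 \le f \le \binom{n}{2}$ there is a deterministic one-pass streaming algorithm $\mathcal{A}_{n,f}$ with the following properties. The input is a stream of insertions and deletions of edges on the vertex set $V = \{1,\dots,n\}$, in arbitrary order, with at most $f$ deletions. At every moment every edge has been inserted at most once more often than it has been deleted, and over the whole stream every edge is deleted at most as often as it is inserted. Write $G - \mathrm{Deletions}$ for the simple unweighted graph on $V$ whose edges are those inserted more often than deleted. (If every edge is inserted at most once, this is the graph $G$ of all inserted edges minus the set $\mathrm{Deletions} \subseteq G$ of deleted edges.) The memory of the algorithm is a bit string that is updated as a function of its present content and of the next stream item only; queries are answered from the memory content alone, and computation time is not restricted. 1. (Space.) At every moment of every such stream the memory of $\mathcal{A}_{n,f}$ has at most $$C\, n^{4/3}\, \max(f,1)^{1/3}\, (\log n)^c$$ bits, that is, $\widetilde{O}(n^{4/3} f^{1/3})$ bits for $f \ge 1$, and $\widetilde{O}(n^{4/3})$ bits for $f=0$. 2. (Queries.) At the end of every such stream, for all $u, v \in V$ simultaneously, the algorithm returns from its memory a value $\widehat{\mathrm{dist}}(u,v)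 \in [0,\infty]$ with $$\mathrm{dist}_{G-\mathrm{Deletions}}(u,v) \;\le\; \widehat{\mathrm{dist}}(u,v) \;\le\; K \log n \,\log\log n \cdot \mathrm{dist}_{G-\mathrm{Deletions}}(u,v),$$ where the distance is $\infty$ if $u$ and $v$ are not connected (so $\widehat{\mathrm{dist}}(u,v)=\infty$ exactly in that case). Logarithms are natural. -/

import Mathlib

/-- An edge slot on the vertex set `Fin n`: an unordered pair of distinct vertices. -/
abbrev EdgeSlot (n : ℕ) : Type := {e : Sym2 (Fin n) // ¬ e.IsDiag}

/-- One item of a graph stream: the insertion or the deletion of an edge. -/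
inductive StreamUpdate (n : ℕ) : Type
  | insert (e : EdgeSlot n)
  | delete (e : EdgeSlot n)
  deriving DecidableEq

/-- Whether a stream item is a deletion. -/
def StreamUpdate.isDelete {n : ℕ} : StreamUpdate n → Bool
  | .insert _ => false
  | .delete _ => true

/-- An insertion stream with at most `f` deletions. The three conditions say: no edge is inserted
while a copy of it is already there (so the graph never has parallel edges); everything that is
deleted is also inserted; there are at most `f` deletions. In particular this covers every
interleaving of single insertions of the edges of a graph `G` with single deletions of at most `f`
edges of `G`, and it also allows a deleted edge to be inserted again. -/
structure IsBoundedDeletionStream {n : ℕ} (f : ℕ) (s : List (StreamUpdate n)) : Prop where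
  noParallel : ∀ t : List (StreamUpdate n), t <+: s →
    ∀ e : EdgeSlot n, t.count (.insert e) ≤ t.count (.delete e) + 1
  deleted_le_inserted : ∀ e : EdgeSlot n, s.count (.delete e) ≤ s.count (.insert e)
  deletions_le : s.countP StreamUpdate.isDelete ≤ f

/-- The graph left at the end of a stream (insertions minus deletions): its edges are the pairs
that were inserted more often than deleted. -/
def residualGraph {n : ℕ} (s : List (StreamUpdate n)) : SimpleGraph (Fin n) :=
  SimpleGraph.fromEdgeSet
    {e | ∃ h : ¬ e.IsDiag, s.count (.delete ⟨e, h⟩) < s.count (.insert ⟨e, h⟩)}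

/-- A deterministic one-pass streaming algorithm on graph streams over `Fin n` that answers
distance queries. Its whole memory between two stream items is a bit string; the next memory
content depends only on the present one and on the item read, and the answer to a query (a
nonnegative number or `∞`) only on the memory content and the queried vertices. -/
structure StreamingDistanceAlgorithm (n : ℕ) : Type where
  init : List Bool
  update : List Bool → StreamUpdate n → List Bool
  query : List Bool → Fin n → Fin n → ENNReal

/-- The memory content after reading a stream. -/
def StreamingDistanceAlgorithm.run {n : ℕ} (A : StreamingDistanceAlgorithm n)
    (s : List (StreamUpdate n)) : List Bool :=
  s.foldl A.update A.init

/-! Any function of the history that determines its own next value can serve as memory.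
`exists_algorithm_of_congruence` encodes its values as bit strings and answers a query by the
largest distance over all streams with the same memory. Deletions are stored verbatim at O(log n)
bits each, so by `exists_algorithm_of_insertion_sketch` only a sequence of distinct insertions has
to be sketched: once the deletions D are revealed, two sequences with equal sketch must have the
same distances up to a factor O(log n log log n).

The structural engine is `exists_isRobust`: a graph with more than about n d log n edges contains a
set S whose surviving vertices stay within distance O(log n log log n) of each other as long as each
of them loses at most d neighbours. S maximises x(Λ - log x)/|S|, where x is the degree sum of G[S]
and Λ = 4 log n. Maximality makes small sets expand better than large ones: the cut around a set of
volume a is at least a log(x/a)/(2Λ). The logarithmic deficit log(x/a) of a growing ball therefore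
shrinks geometrically, and falls below log 2 after O(log n log log n) steps.

If f² ≤ n, an edge is dropped when it lies inside a robust set of the kept graph. The kept graph has
no robust set, hence only about n(f+1) edges up to logarithms, which is within the bound.

If f² > n, take k ≈ (nf)^{1/3}. Edges outside all clusters are stored until there are too many; then
a robust set with d = 4k becomes a cluster, and each vertex of it keeps 2q+1 power sums of its
neighbourhood there, q = f/k. Clusters have degrees above d in disjoint layers, so there are at most
n²/d incidences and about n² f/k² ≈ nk sums. At most q vertices lose 2k or more edges; the others
remain connected inside their clusters. A vertex among these few either has at most q surviving
neighbours in the layer, which the power sums reveal exactly, or so many that one of them is light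
(`SketchEq.exists_light`). -/

open Finset

/-! ### From state machines to bit-string memory -/

/-- `s` is an initial segment of some insertion stream with at most `f` deletions. -/
def IsBoundedPrefix {n : ℕ} (f : ℕ) (t : List (StreamUpdate n)) : Prop :=
  ∃ s, IsBoundedDeletionStream f s ∧ t <+: s

lemma IsBoundedPrefix.of_prefix {n f : ℕ} {t t' : List (StreamUpdate n)}
    (h : IsBoundedPrefix f t) (ht : t' <+: t) : IsBoundedPrefix f t' := by
  obtain ⟨s, hs, hts⟩ := h
  exact ⟨s, hs, ht.trans hts⟩

/-- A function of the history that can be updated from its own value alone and takes at most `2 ^ b`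
values can be kept in `b` bits of memory; whatever it determines up to a factor `L` can be
queried. -/
theorem exists_algorithm_of_congruence {n f b L : ℕ} {X Y : Type*} [Fintype Y]
    (μ : List (StreamUpdate n) → X) (dec : Y → X) (hcard : Fintype.card Y ≤ 2 ^ b)
    (hdec : ∀ t, IsBoundedPrefix f t → μ t ∈ Set.range dec)
    (hstep : ∀ t t' x, IsBoundedPrefix f (t ++ [x]) → IsBoundedPrefix f (t' ++ [x]) →
      μ t = μ t' → μ (t ++ [x]) = μ (t' ++ [x]))
    (hdist : ∀ s s', IsBoundedDeletionStream f s → IsBoundedDeletionStream f s' → μ s = μ s' →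
      ∀ u v, (residualGraph s).edist u v ≤ L * (residualGraph s').edist u v) :
    ∃ A : StreamingDistanceAlgorithm n, ∀ s, IsBoundedDeletionStream f s →
      (∀ t, t <+: s → (A.run t).length ≤ b) ∧
      ∀ u v, ((residualGraph s).edist u v : ENNReal) ≤ A.query (A.run s) u v ∧
        A.query (A.run s) u v ≤ (L : ENNReal) * ((residualGraph s).edist u v : ENNReal) := by
  classical
  have hemb : Nonempty (Y ↪ (Fin b → Bool)) := by
    apply Function.Embedding.nonempty_of_card_le
    simpa using hcard
  obtain ⟨φ⟩ := hemb
  let enc : X → List Bool := fun x =>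
    if h : ∃ y, dec y = x then List.ofFn (φ h.choose) else []
  have henc_len : ∀ x, (enc x).length ≤ b := by
    intro x
    by_cases h : ∃ y, dec y = x <;> simp [enc, h]
  have henc_inj : ∀ x ∈ Set.range dec, ∀ x' ∈ Set.range dec, enc x = enc x' → x = x' := by
    intro x hx x' hx' hxx
    have h : ∃ y, dec y = x := hx
    have h' : ∃ y, dec y = x' := hx'
    simp only [enc, h, h', dif_pos] at hxx
    have := φ.injective (List.ofFn_injective hxx)
    rw [← h.choose_spec, this, h'.choose_spec]
  -- Replay any history that has this memory and may legally be followed by `x`; `hstep` makes the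
  -- choice irrelevant.
  let upd : List Bool → StreamUpdate n → List Bool := fun m x =>
    if h : ∃ t, IsBoundedPrefix f (t ++ [x]) ∧ enc (μ t) = m then enc (μ (h.choose ++ [x])) else []
  let A : StreamingDistanceAlgorithm n :=
    { init := enc (μ [])
      update := upd
      -- The supremum never underestimates the true distance, and `hdist` bounds every competitor by
      -- `L` times it.
      query := fun m u v => ⨆ s : {s // IsBoundedDeletionStream f s ∧ enc (μ s) = m},
        ((residualGraph s.1).edist u v : ENNReal) }
  have hrun : ∀ t, IsBoundedPrefix f t → A.run t = enc (μ t) := by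
    intro t
    induction t using List.reverseRecOn with
    | nil => intro _; rfl
    | append_singleton t x ih =>
      intro ht
      have ht' : IsBoundedPrefix f t := ht.of_prefix (List.prefix_append _ _)
      have h : ∃ t', IsBoundedPrefix f (t' ++ [x]) ∧ enc (μ t') = enc (μ t) := ⟨t, ht, rfl⟩
      have e1 : A.run (t ++ [x]) = upd (A.run t) x := by
        simp [StreamingDistanceAlgorithm.run, A]
      rw [e1, ih ht']
      simp only [upd, dif_pos h]
      congr 1
      refine hstep _ _ x h.choose_spec.1 ht ?_
      exact henc_inj _ (hdec _ (h.choose_spec.1.of_prefix (List.prefix_append _ _))) _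
        (hdec _ ht') h.choose_spec.2
  refine ⟨A, fun s hs => ⟨fun t ht => ?_, fun u v => ?_⟩⟩
  · rw [hrun t ⟨s, hs, ht⟩]
    exact henc_len _
  · rw [hrun s ⟨s, hs, List.prefix_rfl⟩]
    refine ⟨le_iSup (fun s : {s' // IsBoundedDeletionStream f s' ∧ enc (μ s') = enc (μ s)} =>
      ((residualGraph s.1).edist u v : ENNReal)) ⟨s, hs, rfl⟩, ?_⟩
    refine iSup_le ?_
    rintro ⟨s', hs', hss⟩
    have hμ : μ s' = μ s := henc_inj _ (hdec _ ⟨s', hs', List.prefix_rfl⟩) _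
      (hdec _ ⟨s, hs, List.prefix_rfl⟩) hss
    have := ENat.toENNReal_le.2 (hdist s' s hs' hs hμ u v)
    simpa using this

/-! ### Counting multisets -/

/-- The multiset of the entries that are present. -/
def Multiset.ofOptions {α : Type*} {W : ℕ} (g : Fin W → Option α) : Multiset α :=
  Multiset.filterMap id ((Finset.univ : Finset (Fin W)).val.map g)

lemma Multiset.mem_range_ofOptions {α : Type*} {W : ℕ} (m : Multiset α) (h : Multiset.card m ≤ W) :
    m ∈ Set.range (Multiset.ofOptions (α := α) (W := W)) := by
  induction m using Quotient.inductionOn with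
  | h l =>
    have hl : l.length ≤ W := by simpa using h
    refine ⟨fun i => l[i.1]?, ?_⟩
    have h1 : (Finset.univ : Finset (Fin W)).val.map (fun i : Fin W => l[i.1]?)
        = ((List.ofFn fun i : Fin W => l[i.1]?) : Multiset (Option α)) := by
      rw [Fin.univ_val_map]
    rw [Multiset.ofOptions, h1]
    have h2 : (List.ofFn fun i : Fin W => l[i.1]?)
        = l.map some ++ List.replicate (W - l.length) none := by
      apply List.ext_getElem
      · simp; omega
      · intro i h1 h2
        rw [List.getElem_append]
        simp only [List.getElem_ofFn]
        split_ifs with h3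
        · simp at h3; simp [h3]
        · simp at h3; simp [h3]
    rw [h2]
    simp only [Multiset.quot_mk_to_coe, Multiset.filterMap_coe, List.filterMap_append]
    simp

/-! ### From streams to insertion sequences -/

/-- The graph with the given edges. -/
def edgeGraph {n : ℕ} (X : Finset (EdgeSlot n)) : SimpleGraph (Fin n) where
  Adj u v := ∃ h : ¬ (s(u, v) : Sym2 (Fin n)).IsDiag, (⟨s(u, v), h⟩ : EdgeSlot n) ∈ X
  symm := ⟨fun u v => by rw [Sym2.eq_swap]; exact id⟩
  loopless := ⟨fun u => by simp⟩

/-- Cancel each insertion against an earlier deletion of the same edge where possible: the list of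
uncancelled insertions (newest first) and the multiset of uncancelled deletions. -/
def cancelStep {n : ℕ} (p : List (EdgeSlot n) × Multiset (EdgeSlot n)) :
    StreamUpdate n → List (EdgeSlot n) × Multiset (EdgeSlot n)
  | .insert e => if e ∈ p.2 then (p.1, p.2.erase e) else (e :: p.1, p.2)
  | .delete e => (p.1, e ::ₘ p.2)

/-- The uncancelled insertions and deletions of a stream. -/
def cancel {n : ℕ} (s : List (StreamUpdate n)) : List (EdgeSlot n) × Multiset (EdgeSlot n) :=
  s.foldl cancelStep ([], 0)

lemma cancel_append_singleton {n : ℕ} (s : List (StreamUpdate n)) (x : StreamUpdate n) :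
    cancel (s ++ [x]) = cancelStep (cancel s) x := by
  simp [cancel]

/-- Conservation law: cancellation preserves insertions minus deletions of each edge, written
without subtraction. -/
lemma cancel_count {n : ℕ} (s : List (StreamUpdate n)) (e : EdgeSlot n) :
    (cancel s).1.count e + s.count (.delete e) = (cancel s).2.count e + s.count (.insert e) := by
  induction s using List.reverseRecOn with
  | nil => simp [cancel]
  | append_singleton s x ih =>
    rw [cancel_append_singleton]
    cases x with
    | insert a =>
      rw [cancelStep]
      split_ifs with h
      · by_cases hae : e = a
        · subst hae
          have := Multiset.count_pos.2 h
          simp [List.count_append, Multiset.count_erase_self]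
          omega
        · have : a ≠ e := fun h => hae h.symm
          simp [List.count_append, Multiset.count_erase_of_ne hae, this]
          omega
      · by_cases hae : e = a
        · subst hae
          simp [List.count_append]
          omega
        · have : a ≠ e := fun h => hae h.symm
          simp [List.count_append, this]
          omega
    | delete a =>
      rw [cancelStep]
      by_cases hae : e = a
      · subst hae
        simp [List.count_append]
        omega
      · have : a ≠ e := fun h => hae h.symm
        simp [List.count_append, this, Multiset.count_cons_of_ne hae]
        omega

lemma cancel_card_le {n : ℕ} (s : List (StreamUpdate n)) :
    Multiset.card (cancel s).2 ≤ s.countP StreamUpdate.isDelete := by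
  induction s using List.reverseRecOn with
  | nil => simp [cancel]
  | append_singleton s x ih =>
    rw [cancel_append_singleton]
    cases x with
    | insert a =>
      rw [cancelStep]
      have := Multiset.card_le_card (Multiset.erase_le a (cancel s).2)
      split_ifs with h <;> simp [StreamUpdate.isDelete] <;> omega
    | delete a =>
      simp [cancelStep, StreamUpdate.isDelete]
      omega

/-- An insertion that finds no pending deletion must meet an absent edge, because parallel edges are
forbidden. A deletion may precede its insertion, so pending deletions need not refer to edges seen
so far. -/
lemma IsBoundedPrefix.nodup_cancel {n f : ℕ} {t : List (StreamUpdate n)}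
    (h : IsBoundedPrefix f t) : (cancel t).1.Nodup := by
  induction t using List.reverseRecOn with
  | nil => simp [cancel]
  | append_singleton t x ih =>
    have ih := ih (h.of_prefix (List.prefix_append _ _))
    rw [cancel_append_singleton]
    cases x with
    | insert a =>
      rw [cancelStep]
      split_ifs with ha
      · exact ih
      · refine List.nodup_cons.2 ⟨?_, ih⟩
        obtain ⟨s, hs, hts⟩ := h
        have h1 := hs.noParallel _ hts a
        have h2 := cancel_count t a
        rw [Multiset.count_eq_zero_of_notMem ha] at h2
        simp [List.count_append] at h1
        exact List.count_eq_zero.1 (by omega)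
    | delete a => exact ih

lemma IsBoundedPrefix.card_cancel_le {n f : ℕ} {t : List (StreamUpdate n)}
    (h : IsBoundedPrefix f t) : Multiset.card (cancel t).2 ≤ f := by
  obtain ⟨s, hs, hts⟩ := h
  exact (cancel_card_le t).trans ((hts.sublist.countP_le).trans hs.deletions_le)

lemma IsBoundedDeletionStream.cancel_le {n f : ℕ} {s : List (StreamUpdate n)}
    (h : IsBoundedDeletionStream f s) : (cancel s).2 ≤ ((cancel s).1 : Multiset (EdgeSlot n)) := by
  rw [Multiset.le_iff_count]
  intro e
  have h1 := h.deleted_le_inserted e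
  have h2 := cancel_count s e
  have h3 : Multiset.count e ((cancel s).1 : Multiset (EdgeSlot n)) = (cancel s).1.count e := by
    rw [Multiset.coe_count]
    congr!
  omega

lemma IsBoundedDeletionStream.residualGraph_eq {n f : ℕ} {s : List (StreamUpdate n)}
    (h : IsBoundedDeletionStream f s) :
    residualGraph s = edgeGraph ((cancel s).1.toFinset \ (cancel s).2.toFinset) := by
  have hnd : (cancel s).1.Nodup := IsBoundedPrefix.nodup_cancel ⟨s, h, List.prefix_rfl⟩
  ext u v
  simp only [residualGraph, SimpleGraph.fromEdgeSet_adj, Set.mem_ofPred_eq, edgeGraph]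
  constructor
  · rintro ⟨⟨hd, hlt⟩, -⟩
    refine ⟨hd, ?_⟩
    have h2 := cancel_count s ⟨s(u, v), hd⟩
    have h3 := List.nodup_iff_count_le_one.1 hnd ⟨s(u, v), hd⟩
    simp only [Finset.mem_sdiff, List.mem_toFinset, Multiset.mem_toFinset]
    refine ⟨List.count_pos_iff.1 (by omega), fun hm => ?_⟩
    have := Multiset.count_pos.2 hm
    omega
  · rintro ⟨hd, hm⟩
    simp only [Finset.mem_sdiff, List.mem_toFinset, Multiset.mem_toFinset] at hm
    have h2 := cancel_count s ⟨s(u, v), hd⟩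
    have h3 := List.count_pos_iff.2 hm.1
    have h4 := Multiset.count_eq_zero_of_notMem hm.2
    exact ⟨⟨hd, by omega⟩, by simpa using hd⟩

lemma card_edgeSlot_le (n : ℕ) : Fintype.card (EdgeSlot n) ≤ n ^ 2 := by
  rw [Sym2.card_subtype_not_diag, Fintype.card_fin]
  exact Nat.choose_le_pow n 2

lemma le_two_pow_clog (n : ℕ) : n ≤ 2 ^ Nat.clog 2 n := Nat.le_pow_clog (by norm_num) n

lemma one_le_log {n : ℕ} (hn : 3 ≤ n) : 1 ≤ Real.log n := by
  rw [Real.le_log_iff_exp_le (by positivity)]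
  have := Real.exp_one_lt_d9
  have : (3 : ℝ) ≤ n := by exact_mod_cast hn
  linarith

lemma log_le_clog {n : ℕ} (hn : 0 < n) : Real.log n ≤ Nat.clog 2 n := by
  have h1 : (n : ℝ) ≤ 2 ^ Nat.clog 2 n := by exact_mod_cast le_two_pow_clog n
  have h2 := Real.log_le_log (by exact_mod_cast hn) h1
  rw [Real.log_pow] at h2
  have h3 := Real.log_two_lt_d9
  have h4 : (0 : ℝ) ≤ Nat.clog 2 n := Nat.cast_nonneg _
  nlinarith

lemma card_edgeSlot_add_one_le {n : ℕ} (hn : 2 ≤ n) :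
    Fintype.card (EdgeSlot n) + 1 ≤ 2 ^ (3 * Nat.clog 2 n) := by
  calc Fintype.card (EdgeSlot n) + 1 ≤ n ^ 2 + 1 := by gcongr; exact card_edgeSlot_le n
    _ ≤ n ^ 3 := by nlinarith [sq_nonneg (n : ℤ), Nat.pow_le_pow_left hn 2]
    _ ≤ (2 ^ Nat.clog 2 n) ^ 3 := by gcongr; exact le_two_pow_clog n
    _ = _ := by rw [← pow_mul, mul_comm]

/-- It suffices to sketch insertion-only sequences of distinct edges, provided the deletions may be
revealed afterwards: the deletions themselves are kept explicitly. -/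
theorem exists_algorithm_of_insertion_sketch {n f b L : ℕ} (hn : 2 ≤ n) {M Y : Type*} [Fintype Y]
    (mem : List (EdgeSlot n) → M) (dec : Y → M) (hcard : Fintype.card Y ≤ 2 ^ b)
    (hdec : ∀ l, l.Nodup → mem l ∈ Set.range dec)
    (hstep : ∀ l l' e, (e :: l).Nodup → (e :: l').Nodup → mem l = mem l' →
      mem (e :: l) = mem (e :: l'))
    (hdist : ∀ l l', l.Nodup → l'.Nodup → mem l = mem l' → ∀ D : Finset (EdgeSlot n),
      D ⊆ l.toFinset → D ⊆ l'.toFinset → #D ≤ f → ∀ u v,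
        (edgeGraph (l.toFinset \ D)).edist u v ≤ L * (edgeGraph (l'.toFinset \ D)).edist u v) :
    ∃ A : StreamingDistanceAlgorithm n, ∀ s, IsBoundedDeletionStream f s →
      (∀ t, t <+: s → (A.run t).length ≤ b + 3 * Nat.clog 2 n * f) ∧
      ∀ u v, ((residualGraph s).edist u v : ENNReal) ≤ A.query (A.run s) u v ∧
        A.query (A.run s) u v ≤ (L : ENNReal) * ((residualGraph s).edist u v : ENNReal) := by
  refine exists_algorithm_of_congruence (Y := Y × (Fin f → Option (EdgeSlot n)))
    (fun t => (mem (cancel t).1, (cancel t).2))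
    (fun y => (dec y.1, Multiset.ofOptions y.2)) ?_ ?_ ?_ ?_
  · rw [Fintype.card_prod, pow_add]
    refine Nat.mul_le_mul hcard ?_
    rw [Fintype.card_fun, Fintype.card_option, Fintype.card_fin, pow_mul]
    exact Nat.pow_le_pow_left (card_edgeSlot_add_one_le hn) f
  · intro t ht
    obtain ⟨y, hy⟩ := hdec _ ht.nodup_cancel
    obtain ⟨g, hg⟩ := Multiset.mem_range_ofOptions (cancel t).2 ht.card_cancel_le
    exact ⟨(y, g), by simp [hy, hg]⟩
  · intro t t' x ht ht' h
    have h1 := ht.nodup_cancel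
    have h2 := ht'.nodup_cancel
    rw [Prod.mk.injEq] at h
    simp only [cancel_append_singleton] at h1 h2 ⊢
    cases x with
    | insert a =>
      simp only [cancelStep] at h1 h2 ⊢
      -- Both histories have the same pending deletions, so both cancel or neither does.
      rw [← h.2] at h2 ⊢
      split_ifs at h1 h2 ⊢ with ha
      · simp [h.1]
      · simp [hstep _ _ _ h1 h2 h.1]
    | delete a => simp [cancelStep, h.1, h.2]
  · intro s s' hs hs' h u v
    rw [Prod.mk.injEq] at h
    have hp : IsBoundedPrefix f s := ⟨s, hs, List.prefix_rfl⟩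
    have hp' : IsBoundedPrefix f s' := ⟨s', hs', List.prefix_rfl⟩
    rw [hs.residualGraph_eq, hs'.residualGraph_eq, ← h.2]
    refine hdist _ _ hp.nodup_cancel hp'.nodup_cancel h.1 _ ?_ ?_
      ((Multiset.toFinset_card_le _).trans hp.card_cancel_le) u v
    · intro e he
      have := Multiset.mem_of_le hs.cancel_le (Multiset.mem_toFinset.1 he)
      simpa using this
    · intro e he
      rw [h.2] at he
      have := Multiset.mem_of_le hs'.cancel_le (Multiset.mem_toFinset.1 he)
      simpa using this

/-! ### Robustly connected sets in dense graphs -/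

section Robust

open Classical in
/-- Every subgraph of `G[S]`, on a possibly smaller vertex set `S'`, in which every vertex of `S'`
has lost at most `d` of its degree, connects any two vertices of `S'` by a path of length at most
`R`; moreover all degrees in `G[S]` exceed `d`. -/
def IsRobust {V : Type*} (G : SimpleGraph V) (S : Finset V) (d R : ℕ) : Prop :=
  S.Nonempty ∧ (∀ v ∈ S, d < #{w ∈ S | G.Adj v w}) ∧
    ∀ S' ⊆ S, ∀ H : SimpleGraph V, (∀ v ∈ S', ∀ w ∈ S', H.Adj v w → G.Adj v w) →
      (∀ v ∈ S', #{w ∈ S | G.Adj v w} ≤ #{w ∈ S' | H.Adj v w} + d) →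
      ∀ u ∈ S', ∀ v ∈ S', H.edist u v ≤ R

open Classical in
/-- The number of ordered adjacent pairs in `A × B`. -/
noncomputable def adjCount {V : Type*} (G : SimpleGraph V) (A B : Finset V) : ℕ :=
  ∑ v ∈ A, #{w ∈ B | G.Adj v w}

variable {V : Type*} {G : SimpleGraph V}

lemma adjCount_comm (A B : Finset V) : adjCount G A B = adjCount G B A := by
  classical
  simp only [adjCount, card_filter]
  rw [sum_comm]
  simp [G.adj_comm]

open Classical in
lemma adjCount_union_right {A B C : Finset V} (h : Disjoint B C) :
    adjCount G A (B ∪ C) = adjCount G A B + adjCount G A C := by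
  simp only [adjCount, card_filter, sum_union h, sum_add_distrib]

open Classical in
lemma adjCount_union_left {A B C : Finset V} (h : Disjoint A B) :
    adjCount G (A ∪ B) C = adjCount G A C + adjCount G B C := by
  simp only [adjCount, sum_union h]

open Classical in
lemma adjCount_split {A S : Finset V} (h : A ⊆ S) :
    adjCount G S S = adjCount G A A + adjCount G (S \ A) (S \ A) + 2 * adjCount G A (S \ A) := by
  conv_lhs => rw [← union_sdiff_of_subset h]
  rw [adjCount_union_left disjoint_sdiff, adjCount_union_right disjoint_sdiff,
    adjCount_union_right disjoint_sdiff, adjCount_comm (S \ A) A]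
  ring

lemma adjCount_le_mul (A B : Finset V) : adjCount G A B ≤ #A * #B := by
  classical
  rw [adjCount, ← smul_eq_mul]
  exact sum_le_card_nsmul _ _ _ fun v _ => card_filter_le _ _

/-! ### The entropy potential and its consequence for cuts. -/

/-- The potential `x (Λ - log x)`. -/
noncomputable def entropyPotential (Λ x : ℝ) : ℝ := x * (Λ - Real.log x)

lemma log_le_log_of_eq_zero_or {x y : ℝ} (hx : 0 ≤ x) (hxy : x ≤ y) :
    x * Real.log x ≤ x * Real.log y := by
  rcases hx.eq_or_lt with rfl | hx
  · simp
  · exact mul_le_mul_of_nonneg_left (Real.log_le_log hx hxy) hx.le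

/-- Here `a`, `b` are the volumes of the two sides and `c` is the cut. Superadditivity of the
potential reads a log(s/a) + b log(s/b) ≤ 2c(Λ - log s); the second term on the left and the log s
on the right are discarded. -/
lemma cut_lower_bound {Λ a b c s : ℝ} (ha : 0 ≤ a) (hb : 0 ≤ b) (hc : 0 ≤ c) (hs : 1 ≤ s)
    (hsum : s = a + b + 2 * c)
    (hF : entropyPotential Λ a + entropyPotential Λ b ≤ entropyPotential Λ s) :
    a * (Real.log s - Real.log a) ≤ 2 * c * Λ := by
  have h1 := log_le_log_of_eq_zero_or hb (by linarith : b ≤ s)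
  have h2 : 0 ≤ Real.log s := Real.log_nonneg hs
  have h3 : 0 ≤ c * Real.log s := mul_nonneg hc h2
  unfold entropyPotential at hF
  have h4 : s * (Λ - Real.log s) = a * Λ + b * Λ + 2 * c * Λ - a * Real.log s - b * Real.log s
      - 2 * (c * Real.log s) := by
    rw [show s * (Λ - Real.log s) = s * Λ - s * Real.log s by ring]
    nth_rewrite 1 [hsum]
    nth_rewrite 1 [hsum]
    ring
  nlinarith

lemma potential_sub_le {Λ s y : ℝ} (hs : 1 ≤ s) (hy : 0 ≤ y) (hys : y ≤ s) :
    entropyPotential Λ s - entropyPotential Λ (s - y) ≤ y * Λ := by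
  have h1 := log_le_log_of_eq_zero_or (by linarith : 0 ≤ s - y) (by linarith : s - y ≤ s)
  have h2 : 0 ≤ y * Real.log s := mul_nonneg hy (Real.log_nonneg hs)
  unfold entropyPotential
  nlinarith

/-- A quantity that grows by a factor depending on its logarithmic distance to `s` exceeds `s / 2`
soon. -/
lemma exceeds_half_of_growth {Λ s X : ℝ} {R : ℕ} (a : ℕ → ℝ) (hΛ : 0 < Λ) (hX : X ≤ Λ)
    (hs : Real.log s ≤ X) (hs0 : 0 < s) (h0 : 1 ≤ a 0) (hmono : Monotone a)
    (hgrow : ∀ r, a r ≤ s / 2 → a r + a r * (Real.log s - Real.log (a r)) / (2 * Λ) ≤ a (r + 1))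
    (hR : X * Real.exp (-(R : ℝ) / (4 * Λ)) < 1 / 2) : s / 2 < a R := by
  by_contra hcon
  push Not at hcon
  have hle : ∀ r ≤ R, a r ≤ s / 2 := fun r hr => (hmono hr).trans hcon
  have hge : ∀ r, 1 ≤ a r := fun r => h0.trans (hmono (Nat.zero_le r))
  -- With deficit x, one step multiplies `a r` by at least 1 + x/(2Λ); since log(1+y) ≥ y/2 for y ≤
  -- 1, the deficit drops by x/(4Λ).
  have hx : ∀ r ≤ R, Real.log s - Real.log (a r) ≤ X * (1 - 1 / (4 * Λ)) ^ r := by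
    intro r
    induction r with
    | zero =>
      intro _
      have := Real.log_nonneg h0
      simp only [pow_zero, mul_one]
      linarith
    | succ r ih =>
      intro hr
      have ih := ih (by omega)
      set x := Real.log s - Real.log (a r) with hxdef
      have har := hge r
      have hx0 : 0 ≤ x := by
        have : Real.log (a r) ≤ Real.log s :=
          Real.log_le_log (by linarith) (by linarith [hle r (by omega)])
        linarith
      have hx1 : x ≤ Λ := by
        have := Real.log_nonneg har
        linarith
      have h1 := hgrow r (hle r (by omega))
      set y := x / (2 * Λ) with hy
      have hy0 : 0 ≤ y := by positivity
      have hy1 : y ≤ 1 / 2 := by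
        rw [hy, div_le_iff₀ (by positivity)]
        linarith
      have h2 : a r * (1 + y) ≤ a (r + 1) := by
        have e : a r * (1 + y) = a r + a r * x / (2 * Λ) := by
          rw [hy]; ring
        rw [e]; exact h1
      have h3 : Real.log (a r) + Real.log (1 + y) ≤ Real.log (a (r + 1)) := by
        rw [← Real.log_mul (by linarith) (by linarith)]
        exact Real.log_le_log (mul_pos (by linarith) (by linarith)) h2
      have h4 : y / 2 ≤ Real.log (1 + y) := by
        refine le_trans ?_ (Real.le_log_one_add_of_nonneg hy0)
        rw [le_div_iff₀ (by linarith)]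
        nlinarith
      have h5 : y / 2 = x * (1 / (4 * Λ)) := by
        rw [hy]; field_simp; norm_num
      have h6 : (0 : ℝ) ≤ 1 - 1 / (4 * Λ) ∨ x = 0 := by
        by_cases hx00 : x = 0
        · exact Or.inr hx00
        left
        have hl2 : (1 : ℝ) / 2 ≤ Λ := by
          have h7 := Real.log_two_gt_d9
          have h8 : Real.log (a r) ≤ Real.log (s / 2) :=
            Real.log_le_log (by linarith) (hle r (by omega))
          rw [Real.log_div (by linarith) (by norm_num)] at h8
          linarith
        have : 1 / (4 * Λ) ≤ 1 / 2 := by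
          rw [div_le_div_iff₀ (by positivity) (by norm_num)]; linarith
        linarith
      have h7 : (0 : ℝ) ≤ 1 - 1 / (4 * Λ) := by
        rcases h6 with h6 | h6
        · exact h6
        · exfalso
          have h7 := Real.log_two_gt_d9
          have h8 : Real.log (a r) ≤ Real.log (s / 2) :=
            Real.log_le_log (by linarith) (hle r (by omega))
          rw [Real.log_div (by linarith) (by norm_num)] at h8
          linarith
      calc Real.log s - Real.log (a (r + 1)) ≤ x - y / 2 := by linarith
        _ = x * (1 - 1 / (4 * Λ)) := by rw [h5]; ring
        _ ≤ (X * (1 - 1 / (4 * Λ)) ^ r) * (1 - 1 / (4 * Λ)) :=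
            mul_le_mul_of_nonneg_right ih h7
        _ = _ := by rw [pow_succ]; ring
  have h1 := hx R le_rfl
  have hX0 : 0 ≤ X := by
    have : 1 ≤ s := by linarith [hge R]
    exact (Real.log_nonneg this).trans hs
  -- Volume at most `s / 2` means deficit at least log 2 > 1/2, against the decay bound at time `R`.
  have hl : Real.log 2 ≤ Real.log s - Real.log (a R) := by
    have h8 : Real.log (a R) ≤ Real.log (s / 2) := Real.log_le_log (by linarith [hge R]) hcon
    rw [Real.log_div (by linarith) (by norm_num)] at h8
    linarith
  have hl2 := Real.log_two_gt_d9
  have hΛ2 : (1 : ℝ) / 2 ≤ Λ := by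
    have := Real.log_nonneg (hge R)
    linarith
  have h2 : (1 - 1 / (4 * Λ)) ^ R ≤ Real.exp (-(R : ℝ) / (4 * Λ)) := by
    have h3 : 1 - 1 / (4 * Λ) ≤ Real.exp (-(1 / (4 * Λ))) := Real.one_sub_le_exp_neg _
    have h4 : (0 : ℝ) ≤ 1 - 1 / (4 * Λ) := by
      have : 1 / (4 * Λ) ≤ 1 / 2 := by
        rw [div_le_div_iff₀ (by positivity) (by norm_num)]; linarith
      linarith
    calc (1 - 1 / (4 * Λ)) ^ R ≤ Real.exp (-(1 / (4 * Λ))) ^ R := pow_le_pow_left₀ h4 h3 R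
      _ = _ := by
        rw [← Real.exp_nat_mul]; congr 1; ring
  have h3 := mul_le_mul_of_nonneg_left h2 hX0
  linarith

/-! ### Growth of balls in damaged subgraphs. -/

open Classical in
/-- The ball of radius `r` about `u` in the graph induced by `H` on `S`. -/
noncomputable def ballIn (H : SimpleGraph V) (S : Finset V) (u : V) : ℕ → Finset V
  | 0 => {u}
  | r + 1 => ballIn H S u r ∪ {w ∈ S | ∃ v ∈ ballIn H S u r, H.Adj v w}

lemma ballIn_subset {H : SimpleGraph V} {S : Finset V} {u : V} (hu : u ∈ S) (r : ℕ) :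
    ballIn H S u r ⊆ S := by
  classical
  induction r with
  | zero => simpa [ballIn] using hu
  | succ r ih => exact union_subset ih (filter_subset _ _)

lemma edist_le_of_adj {H : SimpleGraph V} {u v : V} (h : H.Adj u v) : H.edist u v ≤ 1 :=
  (SimpleGraph.edist_eq_one_iff_adj.2 h).le

lemma edist_le_of_mem_ballIn {H : SimpleGraph V} {S : Finset V} {u : V} (r : ℕ) :
    ∀ w ∈ ballIn H S u r, H.edist u w ≤ r := by
  classical
  induction r with
  | zero => intro w hw; simp [ballIn] at hw; simp [hw]
  | succ r ih =>
    intro w hw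
    rw [ballIn, mem_union, mem_filter] at hw
    push_cast
    rcases hw with hw | ⟨-, v, hv, hvw⟩
    · exact (ih w hw).trans le_self_add
    · exact SimpleGraph.edist_triangle.trans (add_le_add (ih v hv) (edist_le_of_adj hvw))

open Classical in
/-- Adding to `A` its `H`-neighbours gains twice the cut, up to the lost degree. -/
lemma adjCount_step {H : SimpleGraph V} {S S' A A' : Finset V} {d : ℕ} (hS : S' ⊆ S)
    (hH : ∀ v ∈ S', ∀ w ∈ S', H.Adj v w → G.Adj v w)
    (hloss : ∀ v ∈ S', #{w ∈ S | G.Adj v w} ≤ #{w ∈ S' | H.Adj v w} + d) (hA : A ⊆ S')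
    (hAA : A ⊆ A') (hN : ∀ v ∈ A, ∀ w ∈ S', H.Adj v w → w ∈ A') :
    adjCount G A A + 2 * adjCount G A (S \ A) ≤ adjCount G A' A' + 2 * (d * #A) := by
  have h1 : adjCount G A (S \ A) ≤ adjCount G A (A' \ A) + d * #A := by
    rw [adjCount, adjCount, mul_comm, ← smul_eq_mul, ← sum_const, ← sum_add_distrib]
    refine sum_le_sum fun v hv => ?_
    have h2 := hloss v (hA hv)
    have h3 : #{w ∈ S | G.Adj v w} = #{w ∈ A | G.Adj v w} + #{w ∈ S \ A | G.Adj v w} := by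
      rw [← card_union_of_disjoint (disjoint_filter_filter disjoint_sdiff), ← filter_union,
        union_sdiff_of_subset (hA.trans hS)]
    have h4 : #{w ∈ S' | H.Adj v w} = #{w ∈ A | H.Adj v w} + #{w ∈ S' \ A | H.Adj v w} := by
      rw [← card_union_of_disjoint (disjoint_filter_filter disjoint_sdiff), ← filter_union,
        union_sdiff_of_subset hA]
    have h5 : #{w ∈ A | H.Adj v w} ≤ #{w ∈ A | G.Adj v w} :=
      card_le_card fun w hw => by
        rw [mem_filter] at hw ⊢
        exact ⟨hw.1, hH v (hA hv) w (hA hw.1) hw.2⟩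
    have h6 : #{w ∈ S' \ A | H.Adj v w} ≤ #{w ∈ A' \ A | G.Adj v w} := by
      refine card_le_card fun w hw => ?_
      simp only [mem_filter, mem_sdiff] at hw ⊢
      exact ⟨⟨hN v hv w hw.1.1 hw.2, hw.1.2⟩, hH v (hA hv) w hw.1.1 hw.2⟩
    omega
  have h2 := adjCount_split (G := G) hAA
  omega

open Classical in
/-- The extremal property of a set of maximal potential density: few edges cannot separate it, and
all its degrees are large. -/
lemma exists_max_density [Fintype V] {n : ℕ} (hn : 3 ≤ n) (hV : Fintype.card V = n)
    (hE : 0 < adjCount G univ univ) :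
    ∃ S : Finset V, S.Nonempty ∧ 1 ≤ adjCount G S S ∧
      (∀ A ⊆ S, (adjCount G A A : ℝ) *
          (Real.log (adjCount G S S) - Real.log (adjCount G A A)) ≤
        2 * adjCount G A (S \ A) * (4 * Real.log n)) ∧
      ∀ v ∈ S, adjCount G univ univ ≤ 4 * n * #{w ∈ S | G.Adj v w} := by
  set Λ : ℝ := 4 * Real.log n with hΛ
  have hn0 : (0 : ℝ) < n := by positivity
  have hlog : 0 < Real.log n := Real.log_pos (by exact_mod_cast (by omega : 1 < n))
  set F := entropyPotential Λ with hF
  have hle : ∀ S : Finset V, (adjCount G S S : ℝ) ≤ n ^ 2 := by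
    intro S
    have h1 := adjCount_le_mul (G := G) S S
    have h2 : #S ≤ n := hV ▸ card_le_univ S
    have : adjCount G S S ≤ n ^ 2 := h1.trans (by rw [sq]; exact Nat.mul_le_mul h2 h2)
    exact_mod_cast this
  -- Volumes are at most n², so Λ - log x ≥ 2 log n; this is what the 4 in Λ provides.
  have hFlow : 2 * (adjCount G univ univ : ℝ) * Real.log n ≤ F (adjCount G univ univ) := by
    have hpos : (0 : ℝ) < adjCount G univ univ := by exact_mod_cast hE
    have h1 := Real.log_le_log hpos (hle univ)
    rw [Real.log_pow] at h1
    push_cast at h1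
    rw [hF, entropyPotential, hΛ]
    nlinarith
  have hne : (univ : Finset V).Nonempty := by
    rw [← card_pos, card_univ, hV]; omega
  obtain ⟨S, hS, hmax⟩ := exists_max_image ((univ : Finset (Finset V)).filter Finset.Nonempty)
    (fun S => F (adjCount G S S) / #S) ⟨univ, by simpa using hne⟩
  simp only [mem_filter, mem_univ, true_and] at hS hmax
  set ρ := F (adjCount G S S) / #S with hρ
  have hSc : (0 : ℝ) < #S := by exact_mod_cast card_pos.2 hS
  have hFS : F (adjCount G S S) = ρ * #S := by rw [hρ]; field_simp
  have hFA : ∀ A : Finset V, F (adjCount G A A) ≤ ρ * #A := by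
    intro A
    rcases A.eq_empty_or_nonempty with rfl | hA
    · simp [adjCount, hF, entropyPotential]
    · have := hmax A hA
      rwa [div_le_iff₀ (by exact_mod_cast card_pos.2 hA)] at this
  have hρlow : 2 * (adjCount G univ univ : ℝ) * Real.log n ≤ ρ * n := by
    have := hFA univ
    rw [card_univ, hV] at this
    linarith
  have hρpos : 0 < ρ := by
    have : 0 < 2 * (adjCount G univ univ : ℝ) * Real.log n := by
      have : (0 : ℝ) < adjCount G univ univ := by exact_mod_cast hE
      positivity
    exact pos_of_mul_pos_left (this.trans_le hρlow) hn0.le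
  have hs : 1 ≤ adjCount G S S := by
    by_contra h
    have h0 : adjCount G S S = 0 := by omega
    rw [h0] at hFS
    simp only [hF, entropyPotential, Nat.cast_zero, zero_mul] at hFS
    have : 0 < ρ * #S := mul_pos hρpos hSc
    linarith
  have hsR : (1 : ℝ) ≤ adjCount G S S := by exact_mod_cast hs
  -- Both parts have density at most `ρ`, while `S` attains it.
  have hsplit : ∀ A ⊆ S, F (adjCount G A A) + F (adjCount G (S \ A) (S \ A)) ≤
      F (adjCount G S S) := by
    intro A hA
    have h1 := hFA A
    have h2 := hFA (S \ A)
    have h3 : (#(S \ A) : ℝ) + #A = #S := by exact_mod_cast card_sdiff_add_card_eq_card hA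
    rw [hFS, ← h3]
    linarith
  refine ⟨S, hS, hs, fun A hA => ?_, fun v hv => ?_⟩
  · exact cut_lower_bound (by positivity) (by positivity) (by positivity) hsR
      (by exact_mod_cast adjCount_split hA) (hsplit A hA)
  · have hA : ({v} : Finset V) ⊆ S := by simpa using hv
    have h0 : adjCount G {v} {v} = 0 := by simp [adjCount]
    have h1 := adjCount_split (G := G) hA
    have h2 : adjCount G {v} (S \ {v}) ≤ #{w ∈ S | G.Adj v w} := by
      rw [adjCount, sum_singleton]
      exact card_le_card (filter_subset_filter _ sdiff_subset)
    have h3 := hFA (S \ {v})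
    have h4 : (#(S \ {v}) : ℝ) + 1 = #S := by
      have := card_sdiff_add_card_eq_card hA
      rw [card_singleton] at this
      exact_mod_cast this
    rw [h0] at h1
    have h5 : (adjCount G (S \ {v}) (S \ {v}) : ℝ)
        = adjCount G S S - 2 * adjCount G {v} (S \ {v}) := by
      rw [h1]; push_cast; ring
    have h6 := potential_sub_le (Λ := Λ) (y := 2 * adjCount G {v} (S \ {v})) hsR (by positivity)
      (by rw [h1]; push_cast; linarith [(Nat.cast_nonneg (adjCount G (S \ {v}) (S \ {v})) : (0:ℝ) ≤ _)])
    rw [← h5] at h6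
    -- Removing `v` must lower the potential by at least `ρ`, but lowers it by at most Λ per unit of
    -- lost volume.
    have h7 : ρ ≤ 2 * adjCount G {v} (S \ {v}) * Λ := by
      have e : ρ * #S = ρ * #(S \ {v}) + ρ := by rw [← h4]; ring
      have : F (adjCount G S S) - F (adjCount G (S \ {v}) (S \ {v})) ≤ _ := h6
      linarith
    have h8 : 2 * (adjCount G univ univ : ℝ) * Real.log n ≤
        2 * (4 * n * (adjCount G {v} (S \ {v}) : ℝ)) * Real.log n := by
      refine hρlow.trans ((mul_le_mul_of_nonneg_right h7 hn0.le).trans (le_of_eq ?_))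
      rw [hΛ]; ring
    have h9 : (adjCount G univ univ : ℝ) ≤ 4 * n * (adjCount G {v} (S \ {v}) : ℝ) := by
      have := le_of_mul_le_mul_right h8 hlog
      linarith
    have h10 : adjCount G univ univ ≤ 4 * n * adjCount G {v} (S \ {v}) := by exact_mod_cast h9
    exact h10.trans (Nat.mul_le_mul_left _ h2)

/-- A graph with many edges contains a robustly connected set. -/
theorem exists_isRobust [Fintype V] {n d ℓ R : ℕ} (hn : 3 ≤ n) (hV : Fintype.card V = n)
    (hd : 1 ≤ d) (hℓ : Real.log n ≤ ℓ)
    (hR : 2 * Real.log n * Real.exp (-(R : ℝ) / (16 * Real.log n)) < 1 / 2)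
    (hE : 128 * n * d * ℓ < adjCount G univ univ) : ∃ S, IsRobust G S d (2 * (R + 1)) := by
  classical
  obtain ⟨S, hS, hs, hcut, hdeg⟩ := exists_max_density hn hV (by omega : 0 < adjCount G univ univ)
  have hlog1 := one_le_log hn
  have hℓ1 : 1 ≤ ℓ := by
    have : (1 : ℝ) ≤ ℓ := hlog1.trans hℓ
    exact_mod_cast this
  have hdeg' : ∀ v ∈ S, 32 * d * ℓ < #{w ∈ S | G.Adj v w} := by
    intro v hv
    have h1 := hdeg v hv
    have : 4 * n * (32 * d * ℓ) < 4 * n * #{w ∈ S | G.Adj v w} := by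
      refine lt_of_lt_of_le (lt_of_eq_of_lt ?_ hE) h1
      ring
    exact lt_of_mul_lt_mul_left this (Nat.zero_le _)
  have hdd : ∀ v ∈ S, d + 1 < #{w ∈ S | G.Adj v w} := by
    intro v hv
    have := hdeg' v hv
    have : d * 1 ≤ d * ℓ := Nat.mul_le_mul_left d hℓ1
    nlinarith
  refine ⟨S, hS, fun v hv => by have := hdd v hv; omega, ?_⟩
  intro S' hS' H hH hloss
  set Λ : ℝ := 4 * Real.log n with hΛ
  set s : ℝ := ((adjCount G S S : ℕ) : ℝ) with hsdef
  have hs1 : 1 ≤ s := Nat.one_le_cast.2 hs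
  have hbig : ∀ u ∈ S', s / 2 < adjCount G (ballIn H S' u (R + 1)) (ballIn H S' u (R + 1)) := by
    intro u hu
    -- Radii start at 1 because a single vertex has volume 0, whereas the ball of radius 1 contains
    -- an edge.
    set a : ℕ → ℝ := fun r => adjCount G (ballIn H S' u (r + 1)) (ballIn H S' u (r + 1)) with ha
    have hstep : ∀ r, (adjCount G (ballIn H S' u r) (ballIn H S' u r) : ℝ) +
        2 * adjCount G (ballIn H S' u r) (S \ ballIn H S' u r) ≤
        adjCount G (ballIn H S' u (r + 1)) (ballIn H S' u (r + 1)) + 2 * (d * #(ballIn H S' u r)) := by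
      intro r
      have := adjCount_step hS' hH hloss (ballIn_subset (H := H) hu r)
        (A' := ballIn H S' u (r + 1)) subset_union_left
        (fun v hv w hw hvw => mem_union_right _ (mem_filter.2 ⟨hw, v, hv, hvw⟩))
      exact_mod_cast this
    have hmono : Monotone a := by
      refine monotone_nat_of_le_succ fun r => ?_
      have h1 : ballIn H S' u (r + 1) ⊆ ballIn H S' u (r + 1 + 1) := subset_union_left
      have h2 := adjCount_split (G := G) h1
      have h3 : adjCount G (ballIn H S' u (r + 1)) (ballIn H S' u (r + 1)) ≤
        adjCount G (ballIn H S' u (r + 1 + 1)) (ballIn H S' u (r + 1 + 1)) := by omega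
      exact Nat.cast_le.2 h3
    have h0 : 1 ≤ a 0 := by
      have h1 := hloss u hu
      have h2 := hdd u (hS' hu)
      obtain ⟨w, hw⟩ := card_pos.1 (show 0 < #{w ∈ S' | H.Adj u w} by omega)
      rw [mem_filter] at hw
      have hmu : u ∈ ballIn H S' u 1 := mem_union_left _ (by simp [ballIn])
      have hmw : w ∈ ballIn H S' u 1 :=
        mem_union_right _ (mem_filter.2 ⟨hw.1, u, by simp [ballIn], hw.2⟩)
      have : 1 ≤ adjCount G (ballIn H S' u 1) (ballIn H S' u 1) := by
        rw [adjCount]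
        refine le_trans ?_ (single_le_sum (fun _ _ => Nat.zero_le _) hmu)
        exact card_pos.2 ⟨w, mem_filter.2 ⟨hmw, hH u hu w hw.1 hw.2⟩⟩
      exact Nat.one_le_cast.2 this
    refine exceeds_half_of_growth (Λ := Λ) (X := 2 * Real.log n) a (by positivity) (by linarith) ?_
      (by linarith) h0 hmono ?_ ?_
    · have h1 : adjCount G S S ≤ n ^ 2 := by
        have h2 : #S ≤ n := hV ▸ card_le_univ S
        exact (adjCount_le_mul S S).trans (by rw [sq]; exact Nat.mul_le_mul h2 h2)
      have h2 : s ≤ (n : ℝ) ^ 2 := by rw [hsdef]; exact_mod_cast h1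
      have h3 := Real.log_le_log (by linarith) h2
      rw [Real.log_pow] at h3
      exact_mod_cast h3
    · intro r hr
      have hA := (ballIn_subset (H := H) hu (r + 1)).trans hS'
      have hc := hcut _ hA
      have hst := hstep (r + 1)
      set A := ballIn H S' u (r + 1) with hAdef
      have e1 : a r = adjCount G A A := rfl
      have e2 : a (r + 1) = adjCount G (ballIn H S' u (r + 1 + 1)) (ballIn H S' u (r + 1 + 1)) := rfl
      rw [← e1] at hc hst
      rw [← e2] at hst
      have har : 1 ≤ a r := h0.trans (hmono (Nat.zero_le r))
      set c : ℝ := ((adjCount G A (S \ A) : ℕ) : ℝ) with hcdef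
      have hc0 : 0 ≤ c := by positivity
      have hl2 := Real.log_two_gt_d9
      have hx : Real.log 2 ≤ Real.log s - Real.log (a r) := by
        have h8 : Real.log (a r) ≤ Real.log (s / 2) := Real.log_le_log (by linarith) hr
        rw [Real.log_div (by linarith) (by norm_num)] at h8
        linarith
      have hΛ4 : 4 ≤ Λ := by linarith
      have h1 : a r * 0.69 ≤ 2 * c * Λ :=
        (mul_le_mul_of_nonneg_left (by linarith) (by linarith)).trans hc
      have hvol : (8 * d * Λ) * #A ≤ a r + c := by
        have h2 : #A * (32 * d * ℓ) ≤ adjCount G A A + adjCount G A (S \ A) := by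
          rw [← adjCount_union_right disjoint_sdiff, union_sdiff_of_subset hA, adjCount,
            ← smul_eq_mul]
          exact card_nsmul_le_sum _ _ _ fun v hv => (hdeg' v (hA hv)).le
        have h3 : (#A : ℝ) * (32 * d * ℓ) ≤ a r + c := by
          rw [e1, hcdef]; exact_mod_cast h2
        refine le_trans ?_ h3
        have : (#A : ℝ) * (32 * d * Real.log n) ≤ #A * (32 * d * ℓ) := by gcongr
        rw [hΛ]
        linarith
      -- The cut bound gives a ≤ 3cΛ, so degrees above 32dℓ make the total damage at most half of
      -- the gain 2c.
      have hcc : 2 * (d * #A : ℝ) ≤ c := by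
        have h4 : (8 * (d * #A)) * Λ ≤ (4 * c) * Λ := by
          nlinarith
        have := le_of_mul_le_mul_right h4 (by linarith)
        linarith
      have h5 : a r * (Real.log s - Real.log (a r)) / (2 * Λ) ≤ c := by
        rw [div_le_iff₀ (by linarith)]
        linarith
      linarith
    · rw [hΛ]
      convert hR using 4
      ring
  intro u hu v hv
  -- Two disjoint balls cannot both hold more than half of the volume.
  have hmeet : ¬ Disjoint (ballIn H S' u (R + 1)) (ballIn H S' v (R + 1)) := by
    intro hdis
    have h1 := hbig u hu
    have h2 := hbig v hv
    have h3 := adjCount_split (G := G) ((ballIn_subset (H := H) hu (R + 1)).trans hS')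
    have h4 : ballIn H S' v (R + 1) ⊆ S \ ballIn H S' u (R + 1) := fun w hw =>
      mem_sdiff.2 ⟨hS' (ballIn_subset hv _ hw), disjoint_right.1 hdis hw⟩
    have h5 := adjCount_split (G := G) h4
    have h6 : adjCount G (ballIn H S' u (R + 1)) (ballIn H S' u (R + 1)) +
      adjCount G (ballIn H S' v (R + 1)) (ballIn H S' v (R + 1)) ≤ adjCount G S S := by omega
    have h7 : (adjCount G (ballIn H S' u (R + 1)) (ballIn H S' u (R + 1)) : ℝ) +
      adjCount G (ballIn H S' v (R + 1)) (ballIn H S' v (R + 1)) ≤ s := by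
      rw [hsdef]; exact_mod_cast h6
    linarith
  obtain ⟨w, hwu, hwv⟩ := not_disjoint_iff.1 hmeet
  have h1 := edist_le_of_mem_ballIn _ _ hwu
  have h2 := edist_le_of_mem_ballIn _ _ hwv
  rw [SimpleGraph.edist_comm] at h2
  refine SimpleGraph.edist_triangle.trans ((add_le_add h1 h2).trans (le_of_eq ?_))
  push_cast
  ring

end Robust

/-! ### Graphs given by finite edge sets -/

lemma edgeGraph_mono {n : ℕ} {X Y : Finset (EdgeSlot n)} (h : X ⊆ Y) :
    edgeGraph X ≤ edgeGraph Y := fun _ _ ⟨hd, hm⟩ => ⟨hd, h hm⟩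

open Classical in
/-- The neighbours of `v` along the edges in `X`. -/
noncomputable def edgeNbrs {n : ℕ} (X : Finset (EdgeSlot n)) (v : Fin n) : Finset (Fin n) :=
  {w | (edgeGraph X).Adj v w}

lemma mem_edgeNbrs {n : ℕ} {X : Finset (EdgeSlot n)} {v w : Fin n} :
    w ∈ edgeNbrs X v ↔ (edgeGraph X).Adj v w := by simp [edgeNbrs]

lemma card_edgeNbrs_le {n : ℕ} (X : Finset (EdgeSlot n)) (v : Fin n) : #(edgeNbrs X v) ≤ #X := by
  classical
  have h : (edgeNbrs X v).image (fun w => (s(v, w) : Sym2 (Fin n))) ⊆ X.image Subtype.val := by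
    intro e he
    simp only [mem_image, mem_edgeNbrs] at he
    obtain ⟨w, ⟨hd, hm⟩, rfl⟩ := he
    exact mem_image.2 ⟨_, hm, rfl⟩
  calc #(edgeNbrs X v) = #((edgeNbrs X v).image (fun w => (s(v, w) : Sym2 (Fin n)))) := by
        rw [card_image_of_injective]
        intro a b hab
        exact Sym2.congr_right.1 hab
    _ ≤ #(X.image Subtype.val) := card_le_card h
    _ ≤ #X := card_image_le

open Classical in
lemma sum_card_edgeNbrs {n : ℕ} (X : Finset (EdgeSlot n)) :
    ∑ v, #(edgeNbrs X v) = 2 * #X := by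
  have h1 := (edgeGraph X).sum_degrees_eq_twice_card_edges
  have h2 : (edgeGraph X).edgeFinset = X.map (Function.Embedding.subtype _) := by
    ext e
    induction e with
    | _ u v =>
      simp only [SimpleGraph.mem_edgeFinset, SimpleGraph.mem_edgeSet, mem_map,
        Function.Embedding.subtype_apply]
      constructor
      · rintro ⟨hd, hm⟩
        exact ⟨_, hm, rfl⟩
      · rintro ⟨⟨e, he⟩, hm, rfl⟩
        exact ⟨he, hm⟩
  rw [h2, card_map] at h1
  rw [← h1]
  refine sum_congr rfl fun v _ => ?_
  rw [SimpleGraph.degree]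
  congr 1
  ext w
  simp [mem_edgeNbrs]

lemma adjCount_edgeGraph {n : ℕ} (X : Finset (EdgeSlot n)) :
    adjCount (edgeGraph X) univ univ = 2 * #X := by
  classical
  rw [← sum_card_edgeNbrs, adjCount]
  refine sum_congr rfl fun v _ => ?_
  congr 1

-- A neighbour is lost either with its edge or with its endpoint; this feeds the degree-loss
-- condition of `IsRobust`.
open Classical in
lemma card_filter_adj_le {n : ℕ} (X Y : Finset (EdgeSlot n)) (S S' : Finset (Fin n)) (v : Fin n) :
    #{w ∈ S | (edgeGraph X).Adj v w} ≤
      #{w ∈ S' | (edgeGraph Y).Adj v w} + (#(edgeNbrs (X \ Y) v) + #(S \ S')) := by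
  refine le_trans ?_ ((card_union_le _ _).trans
    (add_le_add_right (card_union_le (edgeNbrs (X \ Y) v) (S \ S')) _))
  refine card_le_card fun w hw => ?_
  simp only [mem_filter, mem_union, mem_edgeNbrs, mem_sdiff] at hw ⊢
  obtain ⟨hwS, hd, hm⟩ := hw
  by_cases h1 : w ∈ S'
  · by_cases h2 : (⟨s(v, w), hd⟩ : EdgeSlot n) ∈ Y
    · exact Or.inl ⟨h1, hd, h2⟩
    · exact Or.inr (Or.inl ⟨hd, mem_sdiff.2 ⟨hm, h2⟩⟩)
  · exact Or.inr (Or.inr ⟨hwS, h1⟩)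

lemma edist_le_mul_edist {V : Type*} {G G' : SimpleGraph V} {L : ℕ} (hL : 1 ≤ L)
    (h : ∀ u v, G'.Adj u v → G.edist u v ≤ L) (u v : V) : G.edist u v ≤ L * G'.edist u v := by
  by_cases ht : G'.edist u v = ⊤
  · rw [ht, ENat.mul_top (by exact_mod_cast (by omega : L ≠ 0))]
    exact le_top
  obtain ⟨p, hp⟩ := SimpleGraph.exists_walk_of_edist_ne_top ht
  rw [← hp]
  clear hp ht
  induction p with
  | nil => simp
  | cons hadj p ih =>
    refine SimpleGraph.edist_triangle.trans ((add_le_add (h _ _ hadj) ih).trans (le_of_eq ?_))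
    rw [SimpleGraph.Walk.length_cons]
    push_cast
    ring

lemma IsRobust.congr {V : Type*} {G G' : SimpleGraph V} {S : Finset V} {d R : ℕ}
    (h : IsRobust G S d R) (hG : ∀ u ∈ S, ∀ v ∈ S, (G.Adj u v ↔ G'.Adj u v)) :
    IsRobust G' S d R := by
  classical
  have hf : ∀ v ∈ S, {w ∈ S | G.Adj v w} = {w ∈ S | G'.Adj v w} := fun v hv =>
    filter_congr fun w hw => hG v hv w hw
  obtain ⟨h1, h2, h3⟩ := h
  refine ⟨h1, fun v hv => ?_, fun S' hS' H hH hl => h3 S' hS' H ?_ ?_⟩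
  · have := h2 v hv
    rwa [hf v hv] at this
  · exact fun v hv w hw hvw => (hG v (hS' hv) w (hS' hw)).2 (hH v hv w hw hvw)
  · intro v hv
    have := hl v hv
    rwa [← hf v (hS' hv)] at this

theorem exists_isRobust_edgeGraph {n d ℓ R : ℕ} (hn : 3 ≤ n) (hd : 1 ≤ d) (hℓ : Real.log n ≤ ℓ)
    (hR : 2 * Real.log n * Real.exp (-(R : ℝ) / (16 * Real.log n)) < 1 / 2)
    {X : Finset (EdgeSlot n)} (hX : 64 * n * d * ℓ < #X) :
    ∃ S, IsRobust (edgeGraph X) S d (2 * (R + 1)) := by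
  refine exists_isRobust hn (Fintype.card_fin n) hd hℓ hR ?_
  rw [adjCount_edgeGraph]
  linarith

/-! ### The fault-tolerant greedy subgraph -/

open Classical in
/-- Keep an edge unless, together with the edges kept so far, it lies in a robust set. -/
noncomputable def greedyEdges {n : ℕ} (d R : ℕ) : List (EdgeSlot n) → Finset (EdgeSlot n)
  | [] => ∅
  | e :: l => if ∃ S, IsRobust (edgeGraph (insert e (greedyEdges d R l))) S d R ∧ ∀ v ∈ e.1, v ∈ S
    then greedyEdges d R l else insert e (greedyEdges d R l)

lemma greedyEdges_subset {n d R : ℕ} (l : List (EdgeSlot n)) : greedyEdges d R l ⊆ l.toFinset := by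
  induction l with
  | nil => simp [greedyEdges]
  | cons e l ih =>
    rw [greedyEdges, List.toFinset_cons]
    split_ifs
    · exact ih.trans (subset_insert _ _)
    · exact insert_subset_insert _ ih

/-- A robust set created by a new edge would contain both its ends, and then the edge would have
been dropped. With `exists_isRobust_edgeGraph` this bounds the number of kept edges. -/
lemma not_isRobust_greedyEdges {n d R : ℕ} (l : List (EdgeSlot n)) (S : Finset (Fin n)) :
    ¬ IsRobust (edgeGraph (greedyEdges d R l)) S d R := by
  classical
  induction l with
  | nil =>
    rintro ⟨⟨v, hv⟩, h, -⟩
    have := h v hv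
    simp [greedyEdges, edgeGraph] at this
  | cons e l ih =>
    rw [greedyEdges]
    split_ifs with h
    · exact ih
    · intro hS
      by_cases he : ∀ v ∈ e.1, v ∈ S
      · exact h ⟨S, hS, he⟩
      · refine ih (hS.congr fun u hu v hv => ⟨?_, ?_⟩)
        · rintro ⟨hd, hm⟩
          refine ⟨hd, (mem_insert.1 hm).resolve_left ?_⟩
          rintro rfl
          exact he fun w hw => by
            rcases Sym2.mem_iff.1 hw with rfl | rfl
            exacts [hu, hv]
        · rintro ⟨hd, hm⟩
          exact ⟨hd, mem_insert_of_mem hm⟩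

/-- A dropped edge lies in a robust set tolerating `f + 1` losses per vertex: the `f` deletions and
the dropped edge itself. -/
lemma edist_greedyEdges_le {n f R : ℕ} (hR : 1 ≤ R) {D : Finset (EdgeSlot n)} (hD : #D ≤ f)
    (l : List (EdgeSlot n)) {u v : Fin n} (h : (edgeGraph (l.toFinset \ D)).Adj u v) :
    (edgeGraph (greedyEdges (f + 1) R l \ D)).edist u v ≤ R := by
  classical
  induction l with
  | nil => obtain ⟨hd, hm⟩ := h; simp at hm
  | cons e l ih =>
    obtain ⟨hd, hm⟩ := h
    rw [List.toFinset_cons, mem_sdiff, mem_insert] at hm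
    rw [greedyEdges]
    split_ifs with hS
    · rcases hm.1 with rfl | hl
      · obtain ⟨S, hrob, huv⟩ := hS
        refine hrob.2.2 S subset_rfl _ (fun _ _ _ _ h => edgeGraph_mono
          (sdiff_subset.trans (subset_insert _ _)) h) (fun w _ => ?_) u (huv u (by simp)) v
          (huv v (by simp))
        set e : EdgeSlot n := ⟨s(u, v), hd⟩
        refine (card_filter_adj_le _ (greedyEdges (f + 1) R l \ D) S S w).trans ?_
        have h1 := card_edgeNbrs_le
          (insert e (greedyEdges (f + 1) R l) \ (greedyEdges (f + 1) R l \ D)) w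
        have h2 : insert e (greedyEdges (f + 1) R l) \ (greedyEdges (f + 1) R l \ D)
            ⊆ insert e D := by
          intro x hx
          simp only [mem_sdiff, mem_insert, not_and, not_not] at hx ⊢
          tauto
        have h3 := (card_le_card h2).trans (card_insert_le e D)
        rw [sdiff_self]
        simp only [bot_eq_empty, card_empty]
        omega
      · exact ih ⟨hd, mem_sdiff.2 ⟨List.mem_toFinset.2 (by simpa using hl), hm.2⟩⟩
    · rcases hm.1 with rfl | hl
      · have h1 : (edgeGraph (insert (⟨s(u, v), hd⟩ : EdgeSlot n) (greedyEdges (f + 1) R l) \ D)).Adj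
            u v := ⟨hd, mem_sdiff.2 ⟨mem_insert_self _ _, hm.2⟩⟩
        refine (edist_le_of_adj h1).trans ?_
        exact_mod_cast hR
      · refine (SimpleGraph.edist_anti (edgeGraph_mono
          (sdiff_subset_sdiff (subset_insert _ _) subset_rfl))).trans
          (ih ⟨hd, mem_sdiff.2 ⟨by simpa using hl, hm.2⟩⟩)

/-- The algorithm that keeps the greedy subgraph. -/
theorem exists_algorithm_greedy {n f R : ℕ} (hn : 3 ≤ n)
    (hR : 2 * Real.log n * Real.exp (-(R : ℝ) / (16 * Real.log n)) < 1 / 2) :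
    ∃ A : StreamingDistanceAlgorithm n, ∀ s, IsBoundedDeletionStream f s →
      (∀ t, t <+: s → (A.run t).length ≤
        3 * Nat.clog 2 n * (64 * n * (f + 1) * Nat.clog 2 n) + 3 * Nat.clog 2 n * f) ∧
      ∀ u v, ((residualGraph s).edist u v : ENNReal) ≤ A.query (A.run s) u v ∧
        A.query (A.run s) u v ≤
          ((2 * (R + 1) : ℕ) : ENNReal) * ((residualGraph s).edist u v : ENNReal) := by
  classical
  have hℓ : Real.log n ≤ Nat.clog 2 n := log_le_clog (by omega)
  set M := 64 * n * (f + 1) * Nat.clog 2 n with hM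
  refine exists_algorithm_of_insertion_sketch (L := 2 * (R + 1)) (Y := Fin M → Option (EdgeSlot n)) (by omega)
    (greedyEdges (f + 1) (2 * (R + 1))) (fun g => (Multiset.ofOptions g).toFinset) ?_ ?_ ?_ ?_
  · rw [Fintype.card_fun, Fintype.card_option, Fintype.card_fin, pow_mul 2 (3 * Nat.clog 2 n) M]
    exact Nat.pow_le_pow_left (card_edgeSlot_add_one_le (by omega)) M
  · intro l _
    have hle : #(greedyEdges (f + 1) (2 * (R + 1)) l) ≤ M := by
      by_contra h
      push Not at h
      obtain ⟨S, hS⟩ := exists_isRobust_edgeGraph hn (Nat.le_add_left 1 f) hℓ hR h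
      exact not_isRobust_greedyEdges l S hS
    obtain ⟨g, hg⟩ := Multiset.mem_range_ofOptions _ hle
    exact ⟨g, by simp only [hg]; exact Finset.val_toFinset _⟩
  · intro l l' e _ _ h
    simp only [greedyEdges, h]
  · intro l l' _ _ h D _ _ hD
    refine edist_le_mul_edist (L := 2 * (R + 1)) (by omega) fun u v huv => ?_
    have h1 := edist_greedyEdges_le (R := 2 * (R + 1)) (by omega) hD l' huv
    rw [← h] at h1
    exact (SimpleGraph.edist_anti (edgeGraph_mono
      (sdiff_subset_sdiff (greedyEdges_subset l) subset_rfl))).trans h1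

/-! ### Sparse recovery by power sums -/

/-- The first `r` power sums, over `ZMod p`, of a set of vertex labels. -/
def powerSums {n : ℕ} (p r : ℕ) (N : Finset (Fin n)) : Fin r → ZMod p :=
  fun j => ∑ w ∈ N, ((w : ℕ) : ZMod p) ^ (j : ℕ)

lemma powerSums_union {n p r : ℕ} {A B : Finset (Fin n)} (h : Disjoint A B) :
    powerSums p r (A ∪ B) = powerSums p r A + powerSums p r B := by
  funext j
  simp [powerSums, sum_union h]

lemma natCast_zmod_injOn {n p : ℕ} (hp : n ≤ p) {a b : Fin n}
    (h : ((a : ℕ) : ZMod p) = ((b : ℕ) : ZMod p)) : a = b := by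
  rw [ZMod.natCast_eq_natCast_iff] at h
  exact Fin.ext (Nat.ModEq.eq_of_lt_of_lt h (a.2.trans_le hp) (b.2.trans_le hp))

lemma card_eq_of_powerSums_eq {n p r : ℕ} (hp : n < p) (hr : 0 < r) {A B : Finset (Fin n)}
    (h : powerSums p r A = powerSums p r B) : #A = #B := by
  have h0 := congrFun h ⟨0, hr⟩
  simp only [powerSums, pow_zero, sum_const, nsmul_eq_mul, mul_one] at h0
  rw [ZMod.natCast_eq_natCast_iff] at h0
  have hA : #A ≤ n := by simpa using card_le_univ A
  have hB : #B ≤ n := by simpa using card_le_univ B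
  exact Nat.ModEq.eq_of_lt_of_lt h0 (by omega) (by omega)

lemma subset_of_powerSums_eq {n p r q : ℕ} [Fact p.Prime] (hp : n ≤ p) (hr : 2 * q ≤ r)
    {A B : Finset (Fin n)} (hA : #A ≤ q) (hB : #B ≤ q)
    (h : powerSums p r A = powerSums p r B) : A ⊆ B := by
  classical
  intro x hx
  by_contra hxB
  -- Equal power sums give equal sums of `P` over `A` and `B`, as its degree is below `r`. But `P`
  -- vanishes on all of `A ∪ B` except at `x`, which lies in `A` only.
  let P : Polynomial (ZMod p) :=
    ∏ y ∈ (A ∪ B).erase x, (Polynomial.X - Polynomial.C ((y : ℕ) : ZMod p))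
  have hdeg : P.natDegree < r := by
    have h1 : P.natDegree = #((A ∪ B).erase x) := Polynomial.natDegree_finsetProd_X_sub_C_eq_card _ _
    rw [h1, card_erase_of_mem (mem_union_left _ hx)]
    have h2 := card_union_le A B
    have h3 : 0 < #(A ∪ B) := card_pos.2 ⟨x, mem_union_left _ hx⟩
    omega
  have hsum : ∑ w ∈ A, P.eval ((w : ℕ) : ZMod p) = ∑ w ∈ B, P.eval ((w : ℕ) : ZMod p) := by
    simp only [Polynomial.eval_eq_sum_range' hdeg]
    rw [sum_comm, sum_comm (s := B)]
    refine sum_congr rfl fun j hj => ?_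
    rw [← mul_sum, ← mul_sum]
    congr 1
    exact congrFun h ⟨j, mem_range.1 hj⟩
  have hzero : ∀ w ∈ A ∪ B, w ≠ x → P.eval ((w : ℕ) : ZMod p) = 0 := by
    intro w hw hwx
    rw [Polynomial.eval_prod]
    exact prod_eq_zero (mem_erase.2 ⟨hwx, hw⟩) (by simp)
  rw [sum_eq_single_of_mem x hx fun w hw hwx => hzero w (mem_union_left _ hw) hwx,
    sum_eq_zero fun w hw => hzero w (mem_union_right _ hw) fun hwx => hxB (hwx ▸ hw),
    Polynomial.eval_prod, prod_eq_zero_iff] at hsum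
  obtain ⟨y, hy, hxy⟩ := hsum
  simp only [Polynomial.eval_sub, Polynomial.eval_X, Polynomial.eval_C, sub_eq_zero] at hxy
  exact (mem_erase.1 hy).1 (natCast_zmod_injOn hp hxy).symm

lemma eq_of_powerSums_eq {n p r q : ℕ} [Fact p.Prime] (hp : n ≤ p) (hr : 2 * q ≤ r)
    {A B : Finset (Fin n)} (hA : #A ≤ q) (hB : #B ≤ q)
    (h : powerSums p r A = powerSums p r B) : A = B :=
  (subset_of_powerSums_eq hp hr hA hB h).antisymm (subset_of_powerSums_eq hp hr hB hA h.symm)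

/-! ### Layers of edges -/

open Classical in
/-- The position of the first cluster containing both ends of `e` (the number of clusters if there
is none). -/
noncomputable def clusterIdx {n : ℕ} (C : List (Finset (Fin n))) (e : EdgeSlot n) : ℕ :=
  C.findIdx fun S => decide (∀ v ∈ e.1, v ∈ S)

/-- The edges of `l` that belong to the cluster number `t`; for `t = C.length`, the edges that
belong to no cluster. -/
noncomputable def layer {n : ℕ} (C : List (Finset (Fin n))) (l : List (EdgeSlot n)) (t : ℕ) :
    Finset (EdgeSlot n) := {e ∈ l.toFinset | clusterIdx C e = t}

lemma mem_layer {n : ℕ} {C : List (Finset (Fin n))} {l : List (EdgeSlot n)} {t : ℕ}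
    {e : EdgeSlot n} : e ∈ layer C l t ↔ e ∈ l ∧ clusterIdx C e = t := by
  simp [layer]

lemma clusterIdx_le {n : ℕ} (C : List (Finset (Fin n))) (e : EdgeSlot n) :
    clusterIdx C e ≤ C.length := List.findIdx_le_length

lemma mem_of_clusterIdx {n : ℕ} {C : List (Finset (Fin n))} {e : EdgeSlot n} {t : ℕ}
    (h : clusterIdx C e = t) (ht : t < C.length) : ∀ v ∈ e.1, v ∈ C[t] := by
  subst h
  exact of_decide_eq_true (List.findIdx_getElem (w := ht))

-- A new cluster takes edges only from the uncovered layer, so the older layers stay as they are.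
open Classical in
lemma clusterIdx_append {n : ℕ} (C : List (Finset (Fin n))) (S : Finset (Fin n)) (e : EdgeSlot n) :
    clusterIdx (C ++ [S]) e = if clusterIdx C e < C.length then clusterIdx C e
      else if ∀ v ∈ e.1, v ∈ S then C.length else C.length + 1 := by
  have h : clusterIdx (C ++ [S]) e = if clusterIdx C e < C.length then clusterIdx C e
      else [S].findIdx (fun S => decide (∀ v ∈ e.1, v ∈ S)) + C.length := List.findIdx_append
  rw [h, List.findIdx_singleton]
  by_cases h1 : clusterIdx C e < C.length
  · rw [if_pos h1, if_pos h1]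
  · rw [if_neg h1, if_neg h1]
    by_cases h2 : ∀ v ∈ e.1, v ∈ S
    · rw [if_pos h2, if_pos (decide_eq_true h2), Nat.zero_add]
    · rw [if_neg h2, if_neg (by simpa using h2), Nat.add_comm]

lemma layer_append_of_lt {n : ℕ} {C : List (Finset (Fin n))} {S : Finset (Fin n)}
    {l : List (EdgeSlot n)} {t : ℕ} (ht : t < C.length) : layer (C ++ [S]) l t = layer C l t := by
  ext e
  rw [mem_layer, mem_layer, clusterIdx_append]
  have := clusterIdx_le C e
  split_ifs <;> constructor <;> rintro ⟨h1, h2⟩ <;> refine ⟨h1, ?_⟩ <;> omega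

open Classical in
lemma layer_append_length {n : ℕ} {C : List (Finset (Fin n))} {S : Finset (Fin n)}
    {l : List (EdgeSlot n)} :
    layer (C ++ [S]) l C.length = {e ∈ layer C l C.length | ∀ v ∈ e.1, v ∈ S} := by
  ext e
  rw [mem_filter, mem_layer, mem_layer, clusterIdx_append]
  have := clusterIdx_le C e
  split_ifs with h1 h2
  · simp only [h1.ne, and_false, false_and]
  · have h3 : clusterIdx C e = C.length := by omega
    exact ⟨fun h => ⟨⟨h.1, h3⟩, h2⟩, fun h => ⟨h.1.1, rfl⟩⟩
  · exact ⟨fun h => absurd h.2 (by omega), fun h => absurd h.2 h2⟩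

open Classical in
lemma layer_append_last {n : ℕ} {C : List (Finset (Fin n))} {S : Finset (Fin n)}
    {l : List (EdgeSlot n)} : layer (C ++ [S]) l (C ++ [S]).length =
      {e ∈ layer C l C.length | ¬ ∀ v ∈ e.1, v ∈ S} := by
  ext e
  rw [mem_filter, mem_layer, mem_layer, clusterIdx_append]
  have := clusterIdx_le C e
  rw [List.length_append, List.length_singleton]
  split_ifs with h1 h2
  · have : clusterIdx C e ≠ C.length + 1 := by omega
    simp only [h1.ne, this, and_false, false_and]
  · exact ⟨fun h => absurd h.2 (by omega), fun h => absurd h2 h.2⟩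
  · have h3 : clusterIdx C e = C.length := by omega
    exact ⟨fun h => ⟨⟨h.1, h3⟩, h2⟩, fun h => ⟨h.1.1, rfl⟩⟩

lemma layer_cons {n : ℕ} (C : List (Finset (Fin n))) (e : EdgeSlot n) (l : List (EdgeSlot n))
    (t : ℕ) : layer C (e :: l) t =
      if clusterIdx C e = t then insert e (layer C l t) else layer C l t := by
  rw [layer, List.toFinset_cons, filter_insert]
  rfl

lemma layer_subset_cons {n : ℕ} (C : List (Finset (Fin n))) (e : EdgeSlot n)
    (l : List (EdgeSlot n)) (t : ℕ) : layer C l t ⊆ layer C (e :: l) t := by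
  rw [layer_cons]
  split_ifs
  exacts [subset_insert _ _, subset_rfl]

lemma layer_subset {n : ℕ} (C : List (Finset (Fin n))) (l : List (EdgeSlot n)) (t : ℕ) :
    layer C l t ⊆ l.toFinset := filter_subset _ _

lemma edgeNbrs_union {n : ℕ} (X Y : Finset (EdgeSlot n)) (v : Fin n) :
    edgeNbrs (X ∪ Y) v = edgeNbrs X v ∪ edgeNbrs Y v := by
  ext w
  rw [mem_union, mem_edgeNbrs, mem_edgeNbrs, mem_edgeNbrs]
  constructor
  · rintro ⟨hd, hm⟩
    exact (mem_union.1 hm).imp (fun h => ⟨hd, h⟩) fun h => ⟨hd, h⟩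
  · rintro (⟨hd, hm⟩ | ⟨hd, hm⟩)
    exacts [⟨hd, mem_union_left _ hm⟩, ⟨hd, mem_union_right _ hm⟩]

lemma disjoint_edgeNbrs {n : ℕ} {X Y : Finset (EdgeSlot n)} (h : Disjoint X Y) (v : Fin n) :
    Disjoint (edgeNbrs X v) (edgeNbrs Y v) := by
  rw [disjoint_left]
  intro w hX hY
  obtain ⟨hd, hm⟩ := mem_edgeNbrs.1 hX
  obtain ⟨_, hm'⟩ := mem_edgeNbrs.1 hY
  exact disjoint_left.1 h hm hm'

lemma powerSums_edgeNbrs_union {n p r : ℕ} {X Y : Finset (EdgeSlot n)} (h : Disjoint X Y)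
    (v : Fin n) : powerSums p r (edgeNbrs (X ∪ Y) v) =
      powerSums p r (edgeNbrs X v) + powerSums p r (edgeNbrs Y v) := by
  rw [edgeNbrs_union, powerSums_union (disjoint_edgeNbrs h v)]

/-- Two edge lists look the same to an observer who knows the clusters, the edges outside them, and
the power sums of all neighbourhoods within each cluster. -/
def SketchEq {n : ℕ} (p r : ℕ) (C : List (Finset (Fin n))) (l l' : List (EdgeSlot n)) : Prop :=
  layer C l C.length = layer C l' C.length ∧ ∀ t < C.length, ∀ v,
    powerSums p r (edgeNbrs (layer C l t) v) = powerSums p r (edgeNbrs (layer C l' t) v)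

/-- Power sums are additive, so a new edge changes both sketches by the same amount. -/
lemma SketchEq.cons {n p r : ℕ} {C : List (Finset (Fin n))} {l l' : List (EdgeSlot n)}
    (h : SketchEq p r C l l') {e : EdgeSlot n} (he : e ∉ l) (he' : e ∉ l') :
    SketchEq p r C (e :: l) (e :: l') := by
  refine ⟨?_, fun t ht v => ?_⟩
  · rw [layer_cons, layer_cons, h.1]
  · rw [layer_cons, layer_cons]
    split_ifs with hi
    · have h1 : Disjoint {e} (layer C l t) := by simp [mem_layer, he]
      have h2 : Disjoint {e} (layer C l' t) := by simp [mem_layer, he']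
      rw [insert_eq, insert_eq, powerSums_edgeNbrs_union h1, powerSums_edgeNbrs_union h2,
        h.2 t ht v]
    · exact h.2 t ht v

/-- The edges entering the new cluster were stored explicitly until now, so their power sums are
computable. -/
lemma SketchEq.append {n p r : ℕ} {C : List (Finset (Fin n))} {l l' : List (EdgeSlot n)}
    (h : SketchEq p r C l l') (S : Finset (Fin n)) : SketchEq p r (C ++ [S]) l l' := by
  refine ⟨?_, fun t ht v => ?_⟩
  · rw [layer_append_last, layer_append_last, h.1]
  · rw [List.length_append, List.length_singleton] at ht
    rcases (Nat.lt_succ_iff_lt_or_eq.1 ht) with ht | rfl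
    · rw [layer_append_of_lt ht, layer_append_of_lt ht, h.2 t ht v]
    · rw [layer_append_length, layer_append_length, h.1]

/-! ### The clustering -/

open Classical in
/-- A robust set of `X`, if there is one. -/
noncomputable def someRobust {n : ℕ} (d R : ℕ) (X : Finset (EdgeSlot n)) : Finset (Fin n) :=
  if h : ∃ S, IsRobust (edgeGraph X) S d R then h.choose else ∅

/-- Whenever more than `M` edges lie outside all clusters, a robust set among them becomes a new
cluster. -/
noncomputable def clusters {n : ℕ} (M d R : ℕ) : List (EdgeSlot n) → List (Finset (Fin n))
  | [] => []
  | e :: l => if M < #(layer (clusters M d R l) (e :: l) (clusters M d R l).length)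
    then clusters M d R l ++
      [someRobust d R (layer (clusters M d R l) (e :: l) (clusters M d R l).length)]
    else clusters M d R l

lemma SketchEq.clusters_cons {n p r M d R : ℕ} {l l' : List (EdgeSlot n)} {e : EdgeSlot n}
    (he : e ∉ l) (he' : e ∉ l') (hC : clusters M d R l = clusters M d R l')
    (h : SketchEq p r (clusters M d R l) l l') :
    clusters M d R (e :: l) = clusters M d R (e :: l') ∧
      SketchEq p r (clusters M d R (e :: l)) (e :: l) (e :: l') := by
  have h1 := h.cons he he'
  rw [clusters, clusters, ← hC, ← h1.1]
  refine ⟨rfl, ?_⟩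
  split_ifs
  exacts [h1.append _, h1]

/-- Each cluster is robust by means of its own edges. -/
def RobustClusters {n : ℕ} (d R : ℕ) (C : List (Finset (Fin n))) (l : List (EdgeSlot n)) : Prop :=
  ∀ t (ht : t < C.length), ∃ H ⊆ layer C l t, IsRobust (edgeGraph H) C[t] d R

lemma clusters_invariant {n M d R : ℕ}
    (hM : ∀ X : Finset (EdgeSlot n), M < #X → ∃ S, IsRobust (edgeGraph X) S d R)
    (l : List (EdgeSlot n)) :
    #(layer (clusters M d R l) l (clusters M d R l).length) ≤ M ∧
      RobustClusters d R (clusters M d R l) l := by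
  classical
  induction l with
  | nil => exact ⟨by simp [layer], fun t ht => by simp [clusters] at ht⟩
  | cons e l ih =>
    rw [clusters]
    set C := clusters M d R l with hC
    -- Layers only gain edges, so the edges that made a cluster robust at its creation remain as
    -- witness.
    have hmono : RobustClusters d R C (e :: l) := fun t ht => by
      obtain ⟨H, hH, hr⟩ := ih.2 t ht
      exact ⟨H, hH.trans (layer_subset_cons _ _ _ _), hr⟩
    split_ifs with hlt
    · set X := layer C (e :: l) C.length with hX
      have hXle : #X ≤ M + 1 := by
        rw [hX, layer_cons]
        split_ifs
        · exact (card_insert_le _ _).trans (Nat.add_le_add_right ih.1 1)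
        · exact ih.1.trans (Nat.le_succ M)
      have hS : IsRobust (edgeGraph X) (someRobust d R X) d R := by
        rw [someRobust, dif_pos (hM X hlt)]
        exact (hM X hlt).choose_spec
      set S := someRobust d R X
      constructor
      · rw [layer_append_last, ← hX]
        -- The overflow is a single edge, and positive degrees in `S` ensure that the cluster
        -- absorbs at least one.
        obtain ⟨v, hv⟩ := hS.1
        obtain ⟨w, hw⟩ := card_pos.1 ((Nat.zero_le d).trans_lt (hS.2.1 v hv))
        rw [mem_filter] at hw
        obtain ⟨hwS, hd, hm⟩ := hw
        have : #{e ∈ X | ¬ ∀ v ∈ e.1, v ∈ S} < #X := by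
          refine card_lt_card (filter_ssubset.2 ⟨_, hm, ?_⟩)
          simp [hv, hwS]
        omega
      · intro t ht
        rw [List.length_append, List.length_singleton] at ht
        rcases (Nat.lt_succ_iff_lt_or_eq.1 ht) with ht | rfl
        · rw [layer_append_of_lt ht, List.getElem_append_left ht]
          exact hmono t ht
        · rw [layer_append_length, ← hX]
          refine ⟨_, subset_rfl, ?_⟩
          rw [List.getElem_concat_length rfl]
          refine hS.congr fun u hu v hv => ⟨?_, ?_⟩
          · rintro ⟨hd, hm⟩
            exact ⟨hd, mem_filter.2 ⟨hm, by simp [hu, hv]⟩⟩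
          · rintro ⟨hd, hm⟩
            exact ⟨hd, (mem_filter.1 hm).1⟩
    · exact ⟨not_lt.1 hlt, hmono⟩

/-! ### Distances are determined by the sketch -/

open Classical in
/-- The vertices at which at least `k` edges are deleted. -/
noncomputable def heavyVertices {n : ℕ} (D : Finset (EdgeSlot n)) (k : ℕ) : Finset (Fin n) :=
  {v | k ≤ #(edgeNbrs D v)}

lemma card_heavyVertices_le {n f k q : ℕ} {D : Finset (EdgeSlot n)} (hD : #D ≤ f)
    (hq : 2 * f < k * (q + 1)) : #(heavyVertices D k) ≤ q := by
  classical
  by_contra h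
  push Not at h
  have h1 : #(heavyVertices D k) • k ≤ ∑ v ∈ heavyVertices D k, #(edgeNbrs D v) :=
    card_nsmul_le_sum _ _ _ fun v hv => (mem_filter.1 hv).2
  have h2 : ∑ v ∈ heavyVertices D k, #(edgeNbrs D v) ≤ ∑ v, #(edgeNbrs D v) :=
    sum_le_sum_of_subset (subset_univ _)
  rw [sum_card_edgeNbrs] at h2
  rw [smul_eq_mul] at h1
  have h3 : (q + 1) * k ≤ #(heavyVertices D k) * k := Nat.mul_le_mul_right k h
  rw [mul_comm k] at hq
  omega

/-- Discard the heavy vertices: a light vertex loses fewer than `k` deleted edges and at most `q`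
heavy neighbours. -/
lemma RobustClusters.edist_le {n d R f k q : ℕ} {C : List (Finset (Fin n))}
    {l : List (EdgeSlot n)} (h : RobustClusters d R C l) {D : Finset (EdgeSlot n)} (hD : #D ≤ f)
    (hq : 2 * f < k * (q + 1)) (hd : k + q ≤ d) {t : ℕ} (ht : t < C.length) {u v : Fin n}
    (hu : u ∈ C[t]) (hv : v ∈ C[t]) (hu' : u ∉ heavyVertices D k) (hv' : v ∉ heavyVertices D k) :
    (edgeGraph (l.toFinset \ D)).edist u v ≤ R := by
  classical
  obtain ⟨H, hH, hr⟩ := h t ht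
  have hHl : H ⊆ l.toFinset := hH.trans (layer_subset _ _ _)
  refine (SimpleGraph.edist_anti (edgeGraph_mono (sdiff_subset_sdiff hHl subset_rfl))).trans ?_
  refine hr.2.2 (C[t] \ heavyVertices D k) sdiff_subset _ (fun _ _ _ _ h =>
    edgeGraph_mono sdiff_subset h) (fun w hw => ?_) u (mem_sdiff.2 ⟨hu, hu'⟩) v
    (mem_sdiff.2 ⟨hv, hv'⟩)
  refine (card_filter_adj_le H (H \ D) C[t] (C[t] \ heavyVertices D k) w).trans
    (Nat.add_le_add_left ?_ _)
  have h1 : #(edgeNbrs (H \ (H \ D)) w) ≤ #(edgeNbrs D w) := by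
    refine card_le_card fun x hx => ?_
    rw [mem_edgeNbrs] at hx ⊢
    refine edgeGraph_mono (fun e he => ?_) hx
    simp only [mem_sdiff, not_and, not_not] at he
    exact he.2 he.1
  have h2 : #(edgeNbrs D w) < k := by
    have := (mem_sdiff.1 hw).2
    simpa [heavyVertices] using this
  have h3 : #(C[t] \ (C[t] \ heavyVertices D k)) ≤ #(heavyVertices D k) :=
    card_le_card fun x hx => by
      simp only [mem_sdiff, not_and, not_not] at hx
      exact hx.2 hx.1
  have h4 := card_heavyVertices_le hD hq
  omega

lemma SketchEq.exists_light {n p r f k q : ℕ} [Fact p.Prime] (hp : n < p) (hr : 2 * q < r)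
    {C : List (Finset (Fin n))} {l l' : List (EdgeSlot n)} (h : SketchEq p r C l l')
    {D : Finset (EdgeSlot n)} (hDl : D ⊆ l.toFinset) (hDl' : D ⊆ l'.toFinset) (hD : #D ≤ f)
    (hq : 2 * f < k * (q + 1)) {t : ℕ} (ht : t < C.length) {u v : Fin n} (hu : u ∈ C[t])
    (huv : (edgeGraph (layer C l' t \ D)).Adj u v) :
    (edgeGraph (l.toFinset \ D)).Adj u v ∨
      ∃ u' ∈ C[t], u' ∉ heavyVertices D k ∧ (edgeGraph (l.toFinset \ D)).edist u u' ≤ 1 := by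
  classical
  by_cases hheavy : u ∈ heavyVertices D k
  swap
  · exact Or.inr ⟨u, hu, hheavy, by simp⟩
  have hsplit : ∀ m : List (EdgeSlot n), D ⊆ m.toFinset →
      powerSums p r (edgeNbrs (layer C m t) u) = powerSums p r (edgeNbrs (layer C m t \ D) u) +
        powerSums p r (edgeNbrs {e ∈ D | clusterIdx C e = t} u) := by
    intro m hm
    have hdis : Disjoint (layer C m t \ D) {e ∈ D | clusterIdx C e = t} :=
      disjoint_left.2 fun e he he' => (mem_sdiff.1 he).2 (mem_filter.1 he').1
    rw [← powerSums_edgeNbrs_union hdis]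
    congr 2
    ext e
    have := @hm e
    simp only [mem_union, mem_sdiff, mem_filter, mem_layer, List.mem_toFinset] at this ⊢
    tauto
  have heq : powerSums p r (edgeNbrs (layer C l t \ D) u) =
      powerSums p r (edgeNbrs (layer C l' t \ D) u) := by
    have := h.2 t ht u
    rw [hsplit l hDl, hsplit l' hDl'] at this
    exact add_right_cancel this
  -- The zeroth power sum is the number of surviving neighbours, which decides between exact
  -- recovery and pigeonhole against the heavy vertices.
  have hcard := card_eq_of_powerSums_eq hp (by omega) heq
  have hmono : edgeGraph (layer C l t \ D) ≤ edgeGraph (l.toFinset \ D) :=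
    edgeGraph_mono (sdiff_subset_sdiff (layer_subset _ _ _) subset_rfl)
  by_cases hsmall : #(edgeNbrs (layer C l t \ D) u) ≤ q
  · left
    have := eq_of_powerSums_eq hp.le (by omega) hsmall (hcard ▸ hsmall) heq
    refine hmono (mem_edgeNbrs.1 ?_)
    rw [this]
    exact mem_edgeNbrs.2 huv
  · right
    have hlt : #(heavyVertices D k) < #(edgeNbrs (layer C l t \ D) u) :=
      (card_heavyVertices_le hD hq).trans_lt (not_le.1 hsmall)
    obtain ⟨w, hw, hw'⟩ := exists_mem_notMem_of_card_lt_card hlt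
    rw [mem_edgeNbrs] at hw
    refine ⟨w, ?_, hw', edist_le_of_adj (hmono hw)⟩
    obtain ⟨hd, hm⟩ := hw
    exact mem_of_clusterIdx (mem_layer.1 (mem_sdiff.1 hm).1).2 ht w (by simp)

/-- An edge that is not itself recovered is replaced by one step to a light vertex at each end and a
robust path between them, whence R + 2. -/
theorem SketchEq.edist_le {n p r f k q d R : ℕ} [Fact p.Prime] (hp : n < p) (hr : 2 * q < r)
    {C : List (Finset (Fin n))} {l l' : List (EdgeSlot n)} (h : SketchEq p r C l l')
    (hC : RobustClusters d R C l) {D : Finset (EdgeSlot n)} (hDl : D ⊆ l.toFinset)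
    (hDl' : D ⊆ l'.toFinset) (hD : #D ≤ f) (hq : 2 * f < k * (q + 1)) (hd : k + q ≤ d)
    (u v : Fin n) : (edgeGraph (l.toFinset \ D)).edist u v ≤
      ((R + 2 : ℕ) : ℕ∞) * (edgeGraph (l'.toFinset \ D)).edist u v := by
  refine edist_le_mul_edist (by omega) (fun u v huv => ?_) u v
  have hadj : ∀ {u v : Fin n}, (edgeGraph (l.toFinset \ D)).Adj u v →
      (edgeGraph (l.toFinset \ D)).edist u v ≤ ((R + 2 : ℕ) : ℕ∞) := fun h =>
    (edist_le_of_adj h).trans (by exact_mod_cast (by omega : 1 ≤ R + 2))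
  obtain ⟨hdg, hm⟩ := huv
  rw [mem_sdiff, List.mem_toFinset] at hm
  rcases (clusterIdx_le C ⟨s(u, v), hdg⟩).lt_or_eq with ht | ht
  · have hu := mem_of_clusterIdx rfl ht u (by simp)
    have hv := mem_of_clusterIdx rfl ht v (by simp)
    have huv : (edgeGraph (layer C l' (clusterIdx C ⟨s(u, v), hdg⟩) \ D)).Adj u v :=
      ⟨hdg, mem_sdiff.2 ⟨mem_layer.2 ⟨hm.1, rfl⟩, hm.2⟩⟩
    rcases h.exists_light hp hr hDl hDl' hD hq ht hu huv with h1 | ⟨u', hu', hlu, hdu⟩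
    · exact hadj h1
    rcases h.exists_light hp hr hDl hDl' hD hq ht hv huv.symm with h1 | ⟨v', hv', hlv, hdv⟩
    · exact hadj h1.symm
    have hmid := hC.edist_le hD hq hd ht hu' hv' hlu hlv
    rw [SimpleGraph.edist_comm] at hdv
    refine SimpleGraph.edist_triangle.trans ((add_le_add hdu
      (SimpleGraph.edist_triangle.trans (add_le_add hmid hdv))).trans (le_of_eq ?_))
    push_cast
    ring
  · have h1 : (⟨s(u, v), hdg⟩ : EdgeSlot n) ∈ layer C l C.length := by
      rw [h.1]
      exact mem_layer.2 ⟨hm.1, ht⟩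
    exact hadj ⟨hdg, mem_sdiff.2 ⟨layer_subset _ _ _ h1, hm.2⟩⟩

/-! ### The cluster sketch and its size -/

/-- The edges outside all clusters, the clusters, and the power sums of the neighbourhoods within
each cluster. -/
noncomputable def clusterSketch {n : ℕ} (p r M d R : ℕ) (l : List (EdgeSlot n)) :
    Finset (EdgeSlot n) × List (Finset (Fin n)) × (ℕ → Fin n → Fin r → ZMod p) :=
  (layer (clusters M d R l) l (clusters M d R l).length, clusters M d R l,
    fun t v => if t < (clusters M d R l).length
      then powerSums p r (edgeNbrs (layer (clusters M d R l) l t) v) else 0)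

lemma clusterSketch_eq_iff {n p r M d R : ℕ} {l l' : List (EdgeSlot n)} :
    clusterSketch p r M d R l = clusterSketch p r M d R l' ↔
      clusters M d R l = clusters M d R l' ∧ SketchEq p r (clusters M d R l) l l' := by
  simp only [clusterSketch, Prod.mk.injEq]
  constructor
  · rintro ⟨h1, h2, h3⟩
    rw [← h2] at h1 h3
    refine ⟨h2, h1, fun t ht v => ?_⟩
    have := congrFun (congrFun h3 t) v
    simpa only [if_pos ht] using this
  · rintro ⟨h1, h2, h3⟩
    rw [← h1]
    refine ⟨h2, rfl, ?_⟩
    funext t v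
    split_ifs with ht
    · exact h3 t ht v
    · rfl

open Classical in
/-- The pairs of a cluster number and a vertex of that cluster. -/
noncomputable def clusterIncidences {n : ℕ} (C : List (Finset (Fin n))) : Finset (ℕ × Fin n) :=
  {i ∈ range C.length ×ˢ univ | i.2 ∈ C.getD i.1 ∅}

/-- Double counting: each incidence uses degree at least `d` in its own layer, and the layers are
disjoint. -/
lemma RobustClusters.card_incidences {n d R : ℕ} {C : List (Finset (Fin n))}
    {l : List (EdgeSlot n)} (h : RobustClusters d R C l) :
    #(clusterIncidences C) * d ≤ n ^ 2 := by
  classical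
  have h1 : ∀ i ∈ clusterIncidences C, d ≤ #(edgeNbrs (layer C l i.1) i.2) := by
    rintro ⟨t, v⟩ hi
    simp only [clusterIncidences, mem_filter, mem_product, mem_range, mem_univ, and_true] at hi
    obtain ⟨ht, hv⟩ := hi
    rw [List.getD_eq_getElem _ _ ht] at hv
    obtain ⟨H, hH, hr⟩ := h t ht
    refine (hr.2.1 v hv).le.trans (card_le_card fun w hw => ?_)
    rw [mem_filter] at hw
    exact mem_edgeNbrs.2 (edgeGraph_mono hH hw.2)
  have h2 : ∑ t ∈ range C.length, #(layer C l t) ≤ Fintype.card (EdgeSlot n) := by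
    rw [← card_biUnion]
    · exact card_le_univ _
    · intro t _ t' _ htt
      exact disjoint_left.2 fun e he he' => htt ((mem_layer.1 he).2.symm.trans (mem_layer.1 he').2)
  calc #(clusterIncidences C) * d
      ≤ ∑ i ∈ clusterIncidences C, #(edgeNbrs (layer C l i.1) i.2) := by
        rw [← smul_eq_mul]
        exact card_nsmul_le_sum _ _ _ h1
    _ ≤ ∑ i ∈ range C.length ×ˢ univ, #(edgeNbrs (layer C l i.1) i.2) :=
        sum_le_sum_of_subset (filter_subset _ _)
    _ = ∑ t ∈ range C.length, ∑ v, #(edgeNbrs (layer C l t) v) := sum_product _ _ _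
    _ = 2 * ∑ t ∈ range C.length, #(layer C l t) := by
        rw [mul_sum]
        exact sum_congr rfl fun t _ => sum_card_edgeNbrs _
    _ ≤ 2 * n.choose 2 := by
        rw [Sym2.card_subtype_not_diag, Fintype.card_fin] at h2
        exact Nat.mul_le_mul_left 2 h2
    _ ≤ n ^ 2 := by
        rw [Nat.choose_two_right, sq]
        exact (Nat.mul_div_le _ _).trans (Nat.mul_le_mul_left n (Nat.sub_le n 1))

lemma RobustClusters.length_le {n d R : ℕ} {C : List (Finset (Fin n))}
    {l : List (EdgeSlot n)} (h : RobustClusters d R C l) : C.length ≤ #(clusterIncidences C) := by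
  classical
  have : range C.length ⊆ (clusterIncidences C).image Prod.fst := by
    intro t ht
    rw [mem_range] at ht
    obtain ⟨H, -, ⟨v, hv⟩, -⟩ := h t ht
    refine mem_image.2 ⟨(t, v), ?_, rfl⟩
    simp only [clusterIncidences, mem_filter, mem_product, mem_range, mem_univ, and_true]
    exact ⟨ht, by rwa [List.getD_eq_getElem _ _ ht]⟩
  calc C.length = #(range C.length) := (card_range _).symm
    _ ≤ _ := (card_le_card this).trans card_image_le

open Classical in
/-- Decoding of clusters and power sums from a multiset of records. -/
noncomputable def decodeClusters {n W : ℕ} {Z : Type*} [Zero Z] (len : ℕ)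
    (Γ : Multiset ((Fin W × Fin n) × Z)) : List (Finset (Fin n)) × (ℕ → Fin n → Z) :=
  (List.ofFn fun t : Fin len =>
      univ.filter fun v => ∃ (τ : Fin W) (x : Z), (τ : ℕ) = t ∧ ((τ, v), x) ∈ Γ,
    fun t v => if h : ∃ x : Z, ∃ τ : Fin W, (τ : ℕ) = t ∧ ((τ, v), x) ∈ Γ then h.choose else 0)

lemma exists_decodeClusters {n W : ℕ} {Z : Type*} [Zero Z] {C : List (Finset (Fin n))}
    (g : ℕ → Fin n → Z) (hlen : C.length ≤ W) (hcard : #(clusterIncidences C) ≤ W)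
    (hg : ∀ t v, g t v ≠ 0 → ∃ ht : t < C.length, v ∈ C[t]) :
    ∃ Γ : Multiset ((Fin W × Fin n) × Z), Multiset.card Γ ≤ W ∧
      decodeClusters C.length Γ = (C, g) := by
  classical
  let Q : Finset (Fin W × Fin n) := {i | ((i.1 : ℕ), i.2) ∈ clusterIncidences C}
  let Γ : Multiset ((Fin W × Fin n) × Z) := Q.val.map fun i => (i, g i.1 i.2)
  have hQ : ∀ (τ : Fin W) (v : Fin n), (τ, v) ∈ Q ↔ ∃ ht : (τ : ℕ) < C.length, v ∈ C[(τ : ℕ)] := by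
    intro τ v
    simp only [Q, clusterIncidences, mem_filter, mem_univ, true_and, mem_product, mem_range,
      and_true]
    constructor
    · rintro ⟨ht, hv⟩
      exact ⟨ht, by rwa [List.getD_eq_getElem _ _ ht] at hv⟩
    · rintro ⟨ht, hv⟩
      exact ⟨ht, by rwa [List.getD_eq_getElem _ _ ht]⟩
  have hΓ : ∀ (τ : Fin W) (v : Fin n) (x : Z), ((τ, v), x) ∈ Γ ↔ (τ, v) ∈ Q ∧ g τ v = x := by
    intro τ v x
    simp only [Γ, Multiset.mem_map, mem_val, Prod.mk.injEq]
    constructor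
    · rintro ⟨i, hi, rfl, rfl⟩
      exact ⟨hi, rfl⟩
    · rintro ⟨hi, hx⟩
      exact ⟨(τ, v), hi, rfl, hx⟩
  refine ⟨Γ, ?_, ?_⟩
  · rw [Multiset.card_map]
    refine le_trans (card_le_card_of_injOn (fun i => ((i.1 : ℕ), i.2)) ?_ ?_) hcard
    · intro i hi
      exact (mem_filter.1 hi).2
    · rintro ⟨τ, v⟩ _ ⟨τ', v'⟩ _ h
      simp only [Prod.mk.injEq] at h
      exact Prod.ext (Fin.ext h.1) h.2
  · rw [decodeClusters, Prod.mk.injEq]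
    constructor
    · refine List.ext_getElem (by simp) fun t h1 h2 => ?_
      rw [List.getElem_ofFn]
      ext v
      simp only [mem_filter, mem_univ, true_and, hΓ, hQ]
      constructor
      · rintro ⟨τ, x, rfl, ⟨_, hv⟩, _⟩
        exact hv
      · intro hv
        exact ⟨⟨t, h2.trans_le hlen⟩, _, rfl, ⟨h2, hv⟩, rfl⟩
    · funext t v
      split_ifs with h
      · obtain ⟨τ, hτ, hx⟩ := h.choose_spec
        rw [← ((hΓ _ _ _).1 hx).2, hτ]
      · by_contra hne
        obtain ⟨ht, hv⟩ := hg t v (Ne.symm hne)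
        exact h ⟨g t v, ⟨t, ht.trans_le hlen⟩, rfl, (hΓ _ _ _).2 ⟨(hQ _ _).2 ⟨ht, hv⟩, rfl⟩⟩

lemma card_records_le {n p r W : ℕ} (hn : 2 ≤ n) (hW : W ≤ n ^ 2) [NeZero p] (hp : p ≤ 2 * n) :
    Fintype.card (Option ((Fin W × Fin n) × (Fin r → ZMod p))) ≤
      2 ^ ((4 + 2 * r) * Nat.clog 2 n) := by
  rw [Fintype.card_option, Fintype.card_prod, Fintype.card_prod, Fintype.card_fun, Fintype.card_fin,
    Fintype.card_fin, Fintype.card_fin, ZMod.card]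
  have h1 := le_two_pow_clog n
  have hp2 : p ≤ n ^ 2 := by nlinarith
  have hpos : 1 ≤ (n ^ 2) ^ r := Nat.one_le_pow _ _ (by positivity)
  calc W * n * p ^ r + 1 ≤ n ^ 2 * n * (n ^ 2) ^ r + 1 := by gcongr
    _ ≤ n ^ 2 * n * (n ^ 2) ^ r * 2 := by
        have : 1 ≤ n ^ 2 * n * (n ^ 2) ^ r :=
          Nat.one_le_iff_ne_zero.2 (by positivity)
        omega
    _ ≤ n ^ 2 * n * (n ^ 2) ^ r * n := by gcongr
    _ = n ^ (4 + 2 * r) := by ring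
    _ ≤ (2 ^ Nat.clog 2 n) ^ (4 + 2 * r) := by gcongr
    _ = _ := by rw [← pow_mul, mul_comm]

/-- The algorithm that keeps the cluster sketch. -/
theorem exists_algorithm_cluster {n f k q d R : ℕ} (hn : 3 ≤ n) (hd : 1 ≤ d)
    (hq : 2 * f < k * (q + 1)) (hkq : k + q ≤ d)
    (hR : 2 * Real.log n * Real.exp (-(R : ℝ) / (16 * Real.log n)) < 1 / 2) :
    ∃ A : StreamingDistanceAlgorithm n, ∀ s, IsBoundedDeletionStream f s →
      (∀ t, t <+: s → (A.run t).length ≤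
        3 * Nat.clog 2 n * (64 * n * d * Nat.clog 2 n) + (3 * Nat.clog 2 n +
          (4 + 2 * (2 * q + 1)) * Nat.clog 2 n * (n ^ 2 / d)) + 3 * Nat.clog 2 n * f) ∧
      ∀ u v, ((residualGraph s).edist u v : ENNReal) ≤ A.query (A.run s) u v ∧
        A.query (A.run s) u v ≤
          ((2 * (R + 1) + 2 : ℕ) : ENNReal) * ((residualGraph s).edist u v : ENNReal) := by
  classical
  obtain ⟨p, hp, hnp, hp2⟩ := Nat.exists_prime_lt_and_le_two_mul n (by omega)
  have : Fact p.Prime := ⟨hp⟩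
  generalize hM : 64 * n * d * Nat.clog 2 n = M
  generalize hW : n ^ 2 / d = W
  have hWn : W ≤ n ^ 2 := hW ▸ Nat.div_le_self _ _
  -- Recovery of sets of size `q` needs 2q sums; the extra one keeps the zeroth sum available when
  -- `q = 0`.
  generalize hr : 2 * q + 1 = r
  have hrob : ∀ X : Finset (EdgeSlot n), M < #X →
      ∃ S, IsRobust (edgeGraph X) S d (2 * (R + 1)) := fun X hX =>
    exists_isRobust_edgeGraph hn hd (log_le_clog (by omega)) hR (hM ▸ hX)
  refine exists_algorithm_of_insertion_sketch (L := 2 * (R + 1) + 2)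
    (Y := (Fin M → Option (EdgeSlot n)) × Fin (W + 1) ×
      (Fin W → Option ((Fin W × Fin n) × (Fin r → ZMod p)))) (by omega)
    (clusterSketch p r M d (2 * (R + 1)))
    (fun y => ((Multiset.ofOptions y.1).toFinset,
      decodeClusters y.2.1 (Multiset.ofOptions y.2.2))) ?_ ?_ ?_ ?_
  · rw [Fintype.card_prod, Fintype.card_prod, pow_add, pow_add]
    refine Nat.mul_le_mul ?_ (Nat.mul_le_mul ?_ ?_)
    · rw [Fintype.card_fun, Fintype.card_option, Fintype.card_fin, pow_mul]
      exact Nat.pow_le_pow_left (card_edgeSlot_add_one_le (by omega)) M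
    · rw [Fintype.card_fin]
      calc W + 1 ≤ n ^ 2 + 1 := Nat.add_le_add_right hWn 1
        _ ≤ n ^ 3 := by nlinarith
        _ ≤ (2 ^ Nat.clog 2 n) ^ 3 := Nat.pow_le_pow_left (le_two_pow_clog n) 3
        _ = _ := by rw [← pow_mul, mul_comm]
    · rw [Fintype.card_fun, Fintype.card_fin, pow_mul]
      exact Nat.pow_le_pow_left (card_records_le (by omega) hWn hp2) W
  · intro l _
    have hinv := clusters_invariant hrob l
    have hinc : #(clusterIncidences (clusters M d (2 * (R + 1)) l)) ≤ W := by
      rw [← hW, Nat.le_div_iff_mul_le (by omega)]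
      exact hinv.2.card_incidences
    have hlen := hinv.2.length_le.trans hinc
    obtain ⟨b, hb⟩ := Multiset.mem_range_ofOptions _ hinv.1
    obtain ⟨Γ, hΓ, hdec⟩ := exists_decodeClusters (W := W) (clusterSketch p r M d (2 * (R + 1)) l).2.2
      hlen hinc (by
        intro t v htv
        by_cases ht : t < (clusters M d (2 * (R + 1)) l).length
        · refine ⟨ht, ?_⟩
          by_contra hv
          refine htv ?_
          simp only [clusterSketch, if_pos ht]
          have : edgeNbrs (layer (clusters M d (2 * (R + 1)) l) l t) v = ∅ := by
            refine eq_empty_of_forall_notMem fun w hw => hv ?_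
            obtain ⟨hd, hm⟩ := mem_edgeNbrs.1 hw
            exact mem_of_clusterIdx (mem_layer.1 hm).2 ht v (by simp)
          rw [this]
          funext j
          simp [powerSums]
        · exact absurd (by simp only [clusterSketch, if_neg ht]) htv)
    obtain ⟨γ, hγ⟩ := Multiset.mem_range_ofOptions Γ hΓ
    refine ⟨(b, ⟨_, Nat.lt_succ_of_le hlen⟩, γ), ?_⟩
    simp only [hb, hγ, hdec]
    exact Prod.ext (Finset.val_toFinset _) rfl
  · intro l l' e hl hl' h
    rw [clusterSketch_eq_iff] at h ⊢
    exact h.2.clusters_cons (List.nodup_cons.1 hl).1 (List.nodup_cons.1 hl').1 h.1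
  · intro l l' _ _ h D hDl hDl' hD u v
    rw [clusterSketch_eq_iff] at h
    exact h.2.edist_le hnp (by omega) (clusters_invariant hrob l).2 hDl hDl' hD hq hkq u v

/-! ### Choice of the parameters -/

lemma clog_le_mul_log {n : ℕ} (hn : 3 ≤ n) : (Nat.clog 2 n : ℝ) ≤ 3 * Real.log n := by
  have h1 := Nat.pow_pred_clog_lt_self (b := 2) (by norm_num) (by omega : 1 < n)
  have h2 : ((2 : ℝ) ^ (Nat.clog 2 n - 1)) ≤ n := by exact_mod_cast h1.le
  have h3 := Real.log_le_log (by positivity) h2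
  rw [Real.log_pow] at h3
  have h4 := Real.log_two_gt_d9
  have h5 := one_le_log hn
  have h6 : (Nat.clog 2 n : ℝ) ≤ ((Nat.clog 2 n - 1 : ℕ) : ℝ) + 1 := by
    exact_mod_cast (by omega : Nat.clog 2 n ≤ Nat.clog 2 n - 1 + 1)
  have h7 : (0 : ℝ) ≤ ((Nat.clog 2 n - 1 : ℕ) : ℝ) := Nat.cast_nonneg _
  nlinarith

/-- A radius of order `log n * log log n` suffices. -/
lemma exists_radius : ∃ K : ℝ, ∀ n : ℕ, 3 ≤ n → ∃ R : ℕ,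
    2 * Real.log n * Real.exp (-(R : ℝ) / (16 * Real.log n)) < 1 / 2 ∧
      ((2 * (R + 1) + 2 : ℕ) : ℝ) ≤ K * (Real.log n * Real.log (Real.log n)) := by
  set c := Real.log (Real.log 3) with hc
  have hlog3 : 1 < Real.log 3 := by
    rw [Real.lt_log_iff_exp_lt (by norm_num)]
    have := Real.exp_one_lt_d9
    linarith
  have hc0 : 0 < c := Real.log_pos hlog3
  refine ⟨32 * (Real.log 4 / c + 1) + 8 / c, fun n hn => ?_⟩
  set x := Real.log n with hx
  have hx1 : 1 ≤ x := one_le_log hn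
  have hx3 : Real.log 3 ≤ x := Real.log_le_log (by norm_num) (by exact_mod_cast hn)
  have hy : c ≤ Real.log x := Real.log_le_log (by linarith) hx3
  set y := Real.log x with hydef
  have hy0 : 0 < y := hc0.trans_le hy
  have h4 : 0 < Real.log 4 := Real.log_pos (by norm_num)
  have hlog4x : Real.log (4 * x) = Real.log 4 + y := Real.log_mul (by norm_num) (by linarith)
  -- Chosen so that the exponential falls below 1/(4x). The constant log log 3 > 0 absorbs the
  -- lower-order terms.
  set R := ⌈16 * x * Real.log (4 * x)⌉₊ + 1 with hR
  have hceil0 : 0 ≤ 16 * x * Real.log (4 * x) := by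
    rw [hlog4x]; positivity
  have hR1 : 16 * x * Real.log (4 * x) < R := by
    rw [hR]; push_cast
    exact (Nat.le_ceil _).trans_lt (lt_add_one _)
  have hR2 : (R : ℝ) ≤ 16 * x * Real.log (4 * x) + 2 := by
    rw [hR]; push_cast
    linarith [(Nat.ceil_lt_add_one hceil0).le]
  refine ⟨R, ?_, ?_⟩
  · have h1 : Real.log (4 * x) < R / (16 * x) := by
      rw [lt_div_iff₀ (by positivity)]; linarith
    have h2 : Real.exp (-(R : ℝ) / (16 * x)) < Real.exp (-Real.log (4 * x)) := by
      rw [Real.exp_lt_exp, neg_div]; linarith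
    rw [Real.exp_neg, Real.exp_log (by positivity)] at h2
    calc 2 * x * Real.exp (-(R : ℝ) / (16 * x)) < 2 * x * (4 * x)⁻¹ := by gcongr
      _ = 1 / 2 := by field_simp; norm_num
  · have h1 : Real.log 4 ≤ Real.log 4 / c * y := by
      rw [div_mul_eq_mul_div, le_div_iff₀ hc0]
      exact mul_le_mul_of_nonneg_left hy h4.le
    have h2 : 8 ≤ 8 / c * (x * y) := by
      rw [div_mul_eq_mul_div, le_div_iff₀ hc0]
      nlinarith
    have h3 : x * (Real.log 4 + y) ≤ x * (Real.log 4 / c * y + y) := by gcongr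
    rw [hlog4x] at hR2
    push_cast
    nlinarith

lemma mul_le_of_cube_le {n m a : ℕ} (h : a ^ 3 ≤ 8 * (n * m)) :
    ((n * a : ℕ) : ℝ) ≤ 2 * ((n : ℝ) ^ (4 / 3 : ℝ) * (m : ℝ) ^ (1 / 3 : ℝ)) := by
  rw [← pow_le_pow_iff_left₀ (by positivity) (by positivity) (by norm_num : 3 ≠ 0)]
  have h1 : ((n : ℝ) ^ (4 / 3 : ℝ)) ^ 3 = (n : ℝ) ^ 4 := by
    rw [← Real.rpow_natCast, ← Real.rpow_mul (by positivity), ← Real.rpow_natCast]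
    norm_num
  have h2 : ((m : ℝ) ^ (1 / 3 : ℝ)) ^ 3 = m := by
    rw [← Real.rpow_natCast, ← Real.rpow_mul (by positivity)]
    norm_num
  rw [mul_pow, mul_pow, h1, h2]
  have h3 : (n * a) ^ 3 ≤ 2 ^ 3 * (n ^ 4 * m) := by
    calc (n * a) ^ 3 = n ^ 3 * a ^ 3 := by ring
      _ ≤ n ^ 3 * (8 * (n * m)) := by gcongr
      _ = _ := by ring
  exact_mod_cast h3

lemma exists_cube_root {N : ℕ} (hN : 2 ≤ N) : ∃ k, N ≤ k ^ 3 ∧ k ^ 3 ≤ 8 * N := by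
  have hex : ∃ k, N ≤ k ^ 3 := ⟨N, Nat.le_self_pow (by norm_num) N⟩
  refine ⟨Nat.find hex, Nat.find_spec hex, ?_⟩
  have h2 : 2 ≤ Nat.find hex := by
    rw [Nat.le_find_iff]
    intro m hm
    interval_cases m <;> omega
  obtain ⟨j, hj⟩ : ∃ j, Nat.find hex = j + 1 := ⟨Nat.find hex - 1, by omega⟩
  have h3 : ¬ N ≤ j ^ 3 := Nat.find_min hex (by omega)
  rw [hj] at h2 ⊢
  calc (j + 1) ^ 3 ≤ (2 * j) ^ 3 := by gcongr; omega
    _ = 8 * j ^ 3 := by ring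
    _ ≤ 8 * N := by omega

/-- Both n³ and f³ are at most n²f² ≤ k⁶, the first because `n ≤ f ^ 2`, the second because `f ≤ n ^
2`. -/
lemma cluster_parameter_bounds {n f k : ℕ} (hf : f ≤ n ^ 2) (hnf : n ≤ f ^ 2)
    (hk : n * f ≤ k ^ 3) : n ≤ k ^ 2 ∧ f ≤ k ^ 2 ∧ f ≤ n * k := by
  have h6 : (n * f) ^ 2 ≤ (k ^ 2) ^ 3 := by
    calc (n * f) ^ 2 ≤ (k ^ 3) ^ 2 := by gcongr
      _ = _ := by ring
  have h1 : n ≤ k ^ 2 := by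
    rw [← Nat.pow_le_pow_iff_left (by norm_num : 3 ≠ 0)]
    calc n ^ 3 = n ^ 2 * n := by ring
      _ ≤ n ^ 2 * f ^ 2 := by gcongr
      _ = (n * f) ^ 2 := by ring
      _ ≤ _ := h6
  have h2 : f ≤ k ^ 2 := by
    rw [← Nat.pow_le_pow_iff_left (by norm_num : 3 ≠ 0)]
    calc f ^ 3 = f * f ^ 2 := by ring
      _ ≤ n ^ 2 * f ^ 2 := by gcongr
      _ = (n * f) ^ 2 := by ring
      _ ≤ _ := h6
  refine ⟨h1, h2, ?_⟩
  rcases le_total k n with h | h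
  · calc f ≤ k * k := by rw [← sq]; exact h2
      _ ≤ n * k := by gcongr
  · calc f ≤ n * n := by rw [← sq]; exact hf
      _ ≤ n * k := by gcongr

lemma cluster_bits_le {n f k c : ℕ} (hn : 1 ≤ n) (hk0 : 1 ≤ k)
    (hnk : n ≤ k ^ 2) (hfk : f ≤ n * k) (hk : n * f ≤ k ^ 3) :
    3 * c * (64 * n * (4 * k) * c) + (3 * c + (4 + 2 * (2 * (f / k) + 1)) * c * (n ^ 2 / (4 * k))) +
      3 * c * f ≤ 777 * (n * k) * c ^ 2 := by
  set q := f / k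
  set W := n ^ 2 / (4 * k)
  have hq : q * k ≤ f := Nat.div_mul_le_self _ _
  have hW : W * (4 * k) ≤ n ^ 2 := Nat.div_mul_le_self _ _
  have h1 : 4 * W ≤ n * k := by
    refine Nat.le_of_mul_le_mul_right ?_ hk0
    calc 4 * W * k = W * (4 * k) := by ring
      _ ≤ n * n := by rw [← sq]; exact hW
      _ ≤ n * k ^ 2 := by gcongr
      _ = n * k * k := by ring
  have h2 : 4 * q * W ≤ n * k := by
    refine Nat.le_of_mul_le_mul_right ?_ (by positivity : 0 < k ^ 2)
    calc 4 * q * W * k ^ 2 = (W * (4 * k)) * (q * k) := by ring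
      _ ≤ n ^ 2 * f := by gcongr
      _ = n * (n * f) := by ring
      _ ≤ n * k ^ 3 := by gcongr
      _ = n * k * k ^ 2 := by ring
  have h3 : (4 + 2 * (2 * q + 1)) * W ≤ 3 * (n * k) := by nlinarith
  have h4 : c ≤ c ^ 2 := Nat.le_self_pow (by norm_num) c
  have h5 : 1 ≤ n * k := Nat.mul_pos hn hk0
  calc 3 * c * (64 * n * (4 * k) * c) + (3 * c + (4 + 2 * (2 * q + 1)) * c * W) + 3 * c * f
      = 768 * (n * k) * c ^ 2 + c * (3 * 1 + (4 + 2 * (2 * q + 1)) * W + 3 * f) := by ring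
    _ ≤ 768 * (n * k) * c ^ 2 + c ^ 2 * (3 * (n * k) + 3 * (n * k) + 3 * (n * k)) := by gcongr
    _ = _ := by ring

lemma greedy_bits_le {n f c : ℕ} (hn : 1 ≤ n) :
    3 * c * (64 * n * (f + 1) * c) + 3 * c * f ≤ 777 * (n * (f + 1)) * c ^ 2 := by
  have h4 : c ≤ c ^ 2 := Nat.le_self_pow (by norm_num) c
  have h5 : f ≤ n * (f + 1) := by nlinarith
  calc 3 * c * (64 * n * (f + 1) * c) + 3 * c * f
      = 192 * (n * (f + 1)) * c ^ 2 + 3 * (c * f) := by ring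
    _ ≤ 192 * (n * (f + 1)) * c ^ 2 + 3 * (c ^ 2 * (n * (f + 1))) := by gcongr
    _ ≤ _ := by nlinarith [Nat.zero_le (n * (f + 1) * c ^ 2)]

/-- The algorithm for given `n` and `f`, with its memory bounded in terms of an approximate cube
root `a` of `n f`. -/
lemma exists_algorithm_of_radius {n f R : ℕ} (hn : 3 ≤ n) (hf : f ≤ n.choose 2)
    (hR : 2 * Real.log n * Real.exp (-(R : ℝ) / (16 * Real.log n)) < 1 / 2) :
    ∃ a : ℕ, a ^ 3 ≤ 8 * (n * max f 1) ∧
    ∃ A : StreamingDistanceAlgorithm n, ∀ s, IsBoundedDeletionStream f s →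
      (∀ t, t <+: s → (A.run t).length ≤ 777 * (n * a) * Nat.clog 2 n ^ 2) ∧
      ∀ u v, ((residualGraph s).edist u v : ENNReal) ≤ A.query (A.run s) u v ∧
        A.query (A.run s) u v ≤
          ((2 * (R + 1) + 2 : ℕ) : ENNReal) * ((residualGraph s).edist u v : ENNReal) := by
  by_cases hcase : max f 1 ^ 2 ≤ n
  · obtain ⟨A, hA⟩ := exists_algorithm_greedy (f := f) hn hR
    refine ⟨f + 1, ?_, A, fun s hs => ⟨fun t ht => ?_, fun u v => ?_⟩⟩
    · have : f + 1 ≤ 2 * max f 1 := by omega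
      calc (f + 1) ^ 3 ≤ (2 * max f 1) ^ 3 := by gcongr
        _ = 8 * (max f 1 ^ 2 * max f 1) := by ring
        _ ≤ _ := by gcongr
    · exact ((hA s hs).1 t ht).trans (greedy_bits_le (by omega))
    · refine ⟨((hA s hs).2 u v).1, ((hA s hs).2 u v).2.trans ?_⟩
      gcongr
      omega
  · have hf2 : 2 ≤ f := by
      by_contra h
      have : max f 1 = 1 := by omega
      rw [this] at hcase
      omega
    have hmax : max f 1 = f := by omega
    rw [hmax] at hcase ⊢
    obtain ⟨k, hk, hk8⟩ := exists_cube_root (N := n * f) (by nlinarith)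
    have hk0 : 1 ≤ k := by
      rcases Nat.eq_zero_or_pos k with rfl | h
      · have : 0 < n * f := by positivity
        omega
      · exact h
    obtain ⟨hnk, hfk, hfnk⟩ := cluster_parameter_bounds (hf.trans (Nat.choose_le_pow n 2))
      (not_le.1 hcase).le hk
    have hqk : f / k ≤ k := by
      rw [sq] at hfk
      exact Nat.div_le_of_le_mul hfk
    -- Threshold 2k leaves at most f/k ≤ k heavy vertices, so a light vertex loses at most 3k ≤ d
    -- neighbours. Stored edges (about nk) balance power sums (about n²f/k²).
    obtain ⟨A, hA⟩ := exists_algorithm_cluster (f := f) (k := 2 * k) (q := f / k) (d := 4 * k) hn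
      (by omega) (by
        have := Nat.lt_mul_div_succ f hk0
        nlinarith) (by omega) hR
    exact ⟨k, hk8, A, fun s hs => ⟨fun t ht => ((hA s hs).1 t ht).trans
      (cluster_bits_le (by omega) hk0 hnk hfnk hk), (hA s hs).2⟩⟩

theorem theorem7p1 :
    ∃ (C K : ℝ) (c : ℕ) (A : (n : ℕ) → (f : ℕ) → StreamingDistanceAlgorithm n),
      ∀ (n f : ℕ), 3 ≤ n → f ≤ n.choose 2 →
        ∀ s : List (StreamUpdate n), IsBoundedDeletionStream f s →
          -- space: at every moment of the stream, in bits
          (∀ t : List (StreamUpdate n), t <+: s →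
            ((((A n f).run t).length : ℕ) : ℝ) ≤
              C * (n : ℝ) ^ (4 / 3 : ℝ) * ((max f 1 : ℕ) : ℝ) ^ (1 / 3 : ℝ) *
                Real.log (n : ℝ) ^ c) ∧
          -- accuracy: distance queries at the end of the stream
          (∀ u v : Fin n,
            ((residualGraph s).edist u v : ENNReal) ≤ (A n f).query ((A n f).run s) u v ∧
            (A n f).query ((A n f).run s) u v ≤
              ENNReal.ofReal (K * (Real.log (n : ℝ) * Real.log (Real.log (n : ℝ)))) *
                ((residualGraph s).edist u v : ENNReal)) := by
  obtain ⟨K, hK⟩ := exists_radius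
  have key : ∀ n f : ℕ, ∃ A : StreamingDistanceAlgorithm n, 3 ≤ n → f ≤ n.choose 2 →
      ∃ a : ℕ, a ^ 3 ≤ 8 * (n * max f 1) ∧
      ∃ L : ℕ, (L : ℝ) ≤ K * (Real.log n * Real.log (Real.log n)) ∧
      ∀ s, IsBoundedDeletionStream f s →
        (∀ t, t <+: s → (A.run t).length ≤ 777 * (n * a) * Nat.clog 2 n ^ 2) ∧
        ∀ u v, ((residualGraph s).edist u v : ENNReal) ≤ A.query (A.run s) u v ∧
          A.query (A.run s) u v ≤ (L : ENNReal) * ((residualGraph s).edist u v : ENNReal) := by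
    intro n f
    by_cases h : 3 ≤ n ∧ f ≤ n.choose 2
    · obtain ⟨R, hR, hL⟩ := hK n h.1
      obtain ⟨a, ha, A, hA⟩ := exists_algorithm_of_radius h.1 h.2 hR
      exact ⟨A, fun _ _ => ⟨a, ha, _, hL, hA⟩⟩
    · exact ⟨⟨[], fun _ _ => [], fun _ _ _ => 0⟩, fun h1 h2 => absurd ⟨h1, h2⟩ h⟩
  choose A hA using key
  -- 13986 = 777 · 2 · 3²: the bit count, the rounding of the cube root, and `Nat.clog` against the
  -- natural logarithm, squared.
  refine ⟨13986, K, 2, A, fun n f hn hf s hs => ?_⟩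
  obtain ⟨a, ha, L, hL, h⟩ := hA n f hn hf
  refine ⟨fun t ht => ?_, fun u v => ⟨((h s hs).2 u v).1, ((h s hs).2 u v).2.trans ?_⟩⟩
  · have h1 : ((((A n f).run t).length : ℕ) : ℝ) ≤
        777 * ((n * a : ℕ) : ℝ) * (Nat.clog 2 n : ℝ) ^ 2 := by
      exact_mod_cast (h s hs).1 t ht
    refine h1.trans ?_
    calc 777 * ((n * a : ℕ) : ℝ) * (Nat.clog 2 n : ℝ) ^ 2
        ≤ 777 * (2 * ((n : ℝ) ^ (4 / 3 : ℝ) * ((max f 1 : ℕ) : ℝ) ^ (1 / 3 : ℝ))) *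
          (3 * Real.log n) ^ 2 := by
          gcongr
          · exact mul_le_of_cube_le ha
          · exact clog_le_mul_log hn
      _ = _ := by ring
  · gcongr
    rw [← ENNReal.ofReal_natCast]
    exact ENNReal.ofReal_le_ofReal hL
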